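/- Hub model with a null component: among $n$ nodes $1,\dots,n$, the first $n_L\le n$ are the leaders. One observes $T$ independent groups $G^{(t)}\in\{0,1\}^n$, $t=1,\dots,T$. Each has a latent label $z_*^{(t)}\in\{0,1,\dots,n_L\}$ (label $0$ means no hub) with $\mathbb P(z_*^{(t)}=i)=\rho_i$, and given $z_*^{(t)}=i$ the nodes appear independently, node $j$ with probability $A_{ij}$, where $A_{ij}\in[0,1]$, $A_{0j}=\pi_j$ are the null-component probabilities, and $A_{ii}=1$ for $1\le i\le n_L$. For labels $z\in\{0,\dots,n_L\}^T$ let $\hat A^z_{ij}=\sum_t G^{(t)}_j1(z^{(t)}=i)/\sum_t 1(z^{(t)}=i)$, and let $\hat z$ be any maximizer over $z$ of the profile log-likelihood $$L_G(z)=\sup_{A}\sum_{t=1}^T\sum_{j=1}^n\big[G_j^{(t)}\log A_{z^{(t)}j}+(1-G_j^{(t)})\log(1-A_{z^{(t)}j})\big],$$ where $A$ ranges over all $(n_L+1)\times n$ matrices (rows indexed from $0$) with entries in $[0,1]$ and $A_{ii}=1$ for $1\le i\le n_L$, with $\log 0=-\infty$ and $0\cdot(-\infty)=0$ (so $L_G(z)=-\infty$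 if some group is labelled by a leader absent from it). All quantities $n,T,\rho,A,d>0,v>0$ (and $n_L$ in (a)) may vary along a sequence; $c_{\min},c_{\max},c_0,b$ are constants. Assume the separation condition (S) for each $i=1,\dots,n_L$ there is $V_i\subset\{1,\dots,n\}$ with $|V_i|\ge vn/n_L$ and $A_{ij}-A_{i'j}\ge d$ for all $j\in V_i$ and all $i'\in\{0,\dots,n_L\}$, $i'\ne i$. (a) Suppose $n_L,n,T\to\infty$; $c_{\min}/n_L\le\rho_i\le c_{\max}/n_L$ for $i=0,\dots,n_L$ with $c_{\min},c_{\max}>0$; $A_{ii'}\le c_0/n_L$ for all $0\le i\le n_L$, $1\le i'\le n_L$, $i\ne i'$, with $c_0>0$; and $$\frac{n_L^2\log n_L}{T}\to0,\quad \frac{n_L^5\log T}{d^2vT}\to0,\quad \frac{n_L^8\log n_L}{d^4v^2n}\to0,\quad \frac{n_L\log n}{T}\to0 .$$ Then $$\max_{0\le i\le n_L,\ 1\le j\le n}\big|\hat A^{\hat z}_{ij}-A_{ij}\big|=o_p(1).$$ (b) Suppose $n_L$ is fixed, $n,T\to\infty$; $\rho_i\ge c_{\min}>0$ for $i=0,\dots,n_L$;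 $A_{ii'}\le b<1$ for all $0\le i\le n_L$, $1\le i'\le n_L$, $i\ne i'$; and $$\frac{\log T}{d^2vT}\to0,\quad d^4v^2n\to\infty,\quad \frac{\log n}{T}\to0 .$$ Then the same conclusion holds. -/

import Mathlib

open MeasureTheory Filter Topology

noncomputable section

/-- Labels are `Fin (nL + 1)`: label `0` is the null component (hubless groups), and label
`k.succ` is the `k`-th leader. Nodes are `Fin n`. The leaders are the first `nL` nodes;
`hubNode h k` is the node of the `k`-th leader. -/
def hubNode {nL n : ℕ} (h : nL ≤ n) (k : Fin nL) : Fin n := Fin.castLE h k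

/-- The admissible matrices `A` (row `0` is `π`): entries in `[0, 1]`, and every leader is
surely present in the groups of which it is the hub. -/
def hubMatrices {nL n : ℕ} (h : nL ≤ n) : Set (Fin (nL + 1) → Fin n → ℝ) :=
  {A | (∀ i j, 0 ≤ A i j ∧ A i j ≤ 1) ∧ ∀ k : Fin nL, A k.succ (hubNode h k) = 1}

/-- Parameters of the hub model with a null component, with `nL` leaders among `n` nodes. -/
structure HubParams (nL n : ℕ) where
  le : nL ≤ n
  ρ : Fin (nL + 1) → ℝ
  A : Fin (nL + 1) → Fin n → ℝ
  ρ_nonneg : ∀ i, 0 ≤ ρ i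
  ρ_sum : ∑ i, ρ i = 1
  A_mem : A ∈ hubMatrices le

/-- `p ^ b * (1 - p) ^ (1 - b)`. -/
def bern (p : ℝ) (b : Bool) : ℝ := if b then p else 1 - p

/-- `(zstar, G)` is a sample of `T` independent groups (with their true labels) from the hub model
with a null component: in each group, the label is `i` with probability `ρ i` and, given the
label `i`, the nodes `j` appear independently with probabilities `A i j`. -/
structure IsHubSample {nL n T : ℕ} {Ω : Type*} [MeasurableSpace Ω] (P : HubParams nL n)
    (μ : Measure Ω) (zstar : Ω → Fin T → Fin (nL + 1)) (G : Ω → Fin T → Fin n → Bool) :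
    Prop where
  measurable_zstar : Measurable zstar
  measurable_G : Measurable G
  law : ∀ (z : Fin T → Fin (nL + 1)) (g : Fin T → Fin n → Bool),
    μ {ω | zstar ω = z ∧ G ω = g} =
      ENNReal.ofReal (∏ t, (P.ρ (z t) * ∏ j, bern (P.A (z t) j) (g t j)))

/-- The log-likelihood `L_G(A | z)` of the data `g` given the labels `z`, with `log 0 = -∞`. -/
def condLogLik {nL n T : ℕ} (g : Fin T → Fin n → Bool) (A : Fin (nL + 1) → Fin n → ℝ)
    (z : Fin T → Fin (nL + 1)) : EReal :=
  ∑ t, ∑ j, ENNReal.log (ENNReal.ofReal (bern (A (z t) j) (g t j)))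

/-- The profile log-likelihood `L_G(z)`: the supremum of `L_G(A | z)` over admissible `A`.
It is `-∞` when some group is labelled by a leader that does not belong to it. -/
def profileLogLik {nL n T : ℕ} (h : nL ≤ n) (g : Fin T → Fin n → Bool)
    (z : Fin T → Fin (nL + 1)) : EReal :=
  ⨆ A ∈ hubMatrices (nL := nL) (n := n) h, condLogLik g A z

/-- `zhat` is a maximum profile likelihood assignment of labels for the data `g`. -/
def IsMaxProfile {nL n T : ℕ} (h : nL ≤ n) (g : Fin T → Fin n → Bool)
    (zhat : Fin T → Fin (nL + 1)) : Prop :=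
  ∀ z, profileLogLik h g z ≤ profileLogLik h g zhat

/-- `Â_ij^z`: the proportion of the groups labelled `i` by `z` in which node `j` appears. -/
def Ahat {nL n T : ℕ} (g : Fin T → Fin n → Bool) (z : Fin T → Fin (nL + 1))
    (i : Fin (nL + 1)) (j : Fin n) : ℝ :=
  (∑ t, if z t = i ∧ g t j = true then (1 : ℝ) else 0) / ∑ t, if z t = i then (1 : ℝ) else 0

/-- `max_{i, j} |Â_ij^z - A_ij|` over all labels `i` (null included) and all nodes `j`. -/
def maxError {nL n T : ℕ} (P : HubParams nL n) (g : Fin T → Fin n → Bool)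
    (z : Fin T → Fin (nL + 1)) : ℝ :=
  ⨆ p : Fin (nL + 1) × Fin n, |Ahat g z p.1 p.2 - P.A p.1 p.2|

/-- For every leader there is a set `V` of at least `v * n / nL` nodes each of which is more
likely, by at least `d`, to appear in its groups than in those of any other label. -/
def HubParams.Separated {nL n : ℕ} (P : HubParams nL n) (d v : ℝ) : Prop :=
  ∃ V : Fin nL → Finset (Fin n), ∀ k : Fin nL,
    v * n / nL ≤ ((V k).card : ℝ) ∧
    ∀ j ∈ V k, ∀ i : Fin (nL + 1), i ≠ k.succ → d ≤ P.A k.succ j - P.A i j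

/-- A leader appears with probability at most `b` in the groups of any other label. -/
def HubParams.CrossLE {nL n : ℕ} (P : HubParams nL n) (b : ℝ) : Prop :=
  ∀ (i : Fin (nL + 1)) (k : Fin nL), i ≠ k.succ → P.A i (hubNode P.le k) ≤ b

/-- `X m = o_p(1)` as `m → ∞`, where `X m` lives on its own probability space. -/
def IsLittleOP {Ω : ℕ → Type*} [∀ m, MeasurableSpace (Ω m)] (μ : ∀ m, Measure (Ω m))
    (X : ∀ m, Ω m → ℝ) : Prop :=
  ∀ ε : ℝ, 0 < ε → Tendsto (fun m => μ m {ω | ε ≤ |X m ω|}) atTop (𝓝 0)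

end

/-! Let `z` be the true labels. The maximality of `ẑ` enters through two facts only: the likelihood
of `(A, z)` is at most that of `(Â^ẑ, ẑ)`, and `ẑ` labels no group by a leader absent from it.

For a fixed matrix `B` and labeling `w`, the probability that `(B, w)` is at least as likely as `(A,
z)` is bounded by a product of Bhattacharyya coefficients, hence by `exp (-∑ (A - B)² / 2)`
(`sum_lik_alternative_le`). If one label of `w` contains many groups of two different true labels, a
single row of `B` has to serve two rows of `A` that (S) keeps apart, so the exponent is large for
every `B` (`Mixes.le_sum_sq`). Given `w`, the frequencies take at most `(T + 1) ^ ((nL + 1) n)`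
values, so a union bound over labelings and frequency matrices shows that with high probability `ẑ`
does not mix (`hubProb_mixes_le`).

A labeling that does not mix agrees with `z`, up to few groups, after a permutation of the labels
(`exists_dominant`). The hubs identify the permutation: a true label other than leader `k` cannot be
carried to `k`, since too few of its groups contain `k`. Each label thus goes to itself or to the
null label, and injectivity leaves the identity. Then `Â^ẑ` is close to `Â^z` (`maxError_le`), which
is close to `A` by Chernoff bounds.

The regimes (a) and (b) differ only in how their rates make the finite-sample bound
`IsHubSample.measure_maxError_le` vanish. -/

/-! ### The likelihood as a real number -/

/-- The likelihood of the data `g` given the labels `z`. -/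
def lik {K n T : ℕ} (g : Fin T → Fin n → Bool) (A : Fin K → Fin n → ℝ)
    (z : Fin T → Fin K) : ℝ :=
  ∏ t, ∏ j, bern (A (z t) j) (g t j)

/-- The entries of `A` lie in `[0, 1]`. -/
def UnitEntries {K n : ℕ} (A : Fin K → Fin n → ℝ) : Prop := ∀ i j, 0 ≤ A i j ∧ A i j ≤ 1

theorem bern_nonneg {p : ℝ} (h0 : 0 ≤ p) (h1 : p ≤ 1) (b : Bool) : 0 ≤ bern p b := by
  unfold bern; split <;> linarith

theorem lik_nonneg {K n T : ℕ} (g : Fin T → Fin n → Bool) {A : Fin K → Fin n → ℝ}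
    (hA : UnitEntries A) (z : Fin T → Fin K) : 0 ≤ lik g A z :=
  Finset.prod_nonneg fun _ _ => Finset.prod_nonneg fun j _ =>
    bern_nonneg (hA _ j).1 (hA _ j).2 _

theorem ENNReal.log_finset_prod {ι : Type*} (s : Finset ι) (f : ι → ENNReal) :
    ENNReal.log (∏ i ∈ s, f i) = ∑ i ∈ s, ENNReal.log (f i) := by
  classical
  induction s using Finset.induction_on with
  | empty => simp
  | insert a s ha ih => rw [Finset.prod_insert ha, Finset.sum_insert ha, ENNReal.log_mul_add, ih]

theorem condLogLik_eq_log_lik {nL n T : ℕ} (g : Fin T → Fin n → Bool)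
    {A : Fin (nL + 1) → Fin n → ℝ} (hA : UnitEntries A) (z : Fin T → Fin (nL + 1)) :
    condLogLik g A z = ENNReal.log (ENNReal.ofReal (lik g A z)) := by
  have hb : ∀ t j, 0 ≤ bern (A (z t) j) (g t j) := fun t j =>
    bern_nonneg (hA _ j).1 (hA _ j).2 _
  unfold condLogLik lik
  rw [ENNReal.ofReal_prod_of_nonneg fun t _ => Finset.prod_nonneg fun j _ => hb t j,
    ENNReal.log_finset_prod]
  refine Finset.sum_congr rfl fun t _ => ?_
  rw [ENNReal.ofReal_prod_of_nonneg fun j _ => hb t j, ENNReal.log_finset_prod]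

/-! ### The empirical frequencies maximize the likelihood -/

/-- The Bernoulli likelihood is maximized by the empirical frequency. -/
theorem prod_bern_le_prod_bern_freq {ι : Type*} (S : Finset ι) (h : ι → Bool) {x : ℝ}
    (hx0 : 0 ≤ x) (hx1 : x ≤ 1) :
    ∏ t ∈ S, bern x (h t) ≤
      ∏ t ∈ S, bern (((S.filter fun t => h t = true).card : ℝ) / S.card) (h t) := by
  set s : ℝ := ((S.filter fun t => h t = true).card : ℝ) with hs
  set f : ℝ := ((S.filter fun t => ¬ h t = true).card : ℝ) with hf
  set r : ℝ := (S.card : ℝ) with hr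
  have hsf : s + f = r := by
    rw [hs, hf, hr, ← Nat.cast_add, Finset.card_filter_add_card_filter_not]
  have hs0 : 0 ≤ s := by positivity
  have hf0 : 0 ≤ f := by positivity
  have hpos : ∀ t ∈ S, 0 < bern (s / r) (h t) := by
    intro t ht
    unfold bern
    split
    · next hh =>
      have : 0 < s := by
        rw [hs]; exact_mod_cast Finset.card_pos.2 ⟨t, by simp [ht, hh]⟩
      have : 0 < r := by linarith
      positivity
    · next hh =>
      have : 0 < f := by
        rw [hf]; exact_mod_cast Finset.card_pos.2 ⟨t, by simp [ht, hh]⟩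
      have : 0 < r := by linarith
      have : s / r < 1 := by rw [div_lt_one this]; linarith
      linarith
  -- By `y ≤ exp (y - 1)` for each likelihood ratio `y`, it suffices that the ratios sum to at most
  -- `r x + r (1 - x) = r`. An outcome that never occurs contributes `0`, hence inequalities in `b1`
  -- and `b2`.
  have hsum : ∑ t ∈ S, (bern x (h t) / bern (s / r) (h t) - 1) ≤ 0 := by
    rw [Finset.sum_sub_distrib, ← Finset.sum_filter_add_sum_filter_not S (fun t => h t = true)]
    have e1 : ∑ t ∈ S with h t = true, bern x (h t) / bern (s / r) (h t) = s * (x / (s / r)) := by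
      rw [Finset.sum_congr rfl (g := fun _ => x / (s / r))]
      · simp [hs]
      · intro t ht
        simp [bern, (Finset.mem_filter.1 ht).2]
    have e2 : ∑ t ∈ S with ¬ h t = true, bern x (h t) / bern (s / r) (h t)
        = f * ((1 - x) / (1 - s / r)) := by
      rw [Finset.sum_congr rfl (g := fun _ => (1 - x) / (1 - s / r))]
      · simp [hf]
      · intro t ht
        simp [bern, (Finset.mem_filter.1 ht).2]
    have b1 : s * (x / (s / r)) ≤ r * x := by
      rcases hs0.eq_or_lt with h | h
      · rw [← h]; have : 0 ≤ r := by linarith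
        simp; positivity
      · have : 0 < r := by linarith
        apply le_of_eq; field_simp
    have b2 : f * ((1 - x) / (1 - s / r)) ≤ r * (1 - x) := by
      rcases hf0.eq_or_lt with h | h
      · rw [← h]; have : 0 ≤ r := by linarith
        have : 0 ≤ 1 - x := by linarith
        simp; positivity
      · have : 0 < r := by linarith
        have e : 1 - s / r = f / r := by field_simp; linarith
        rw [e]
        apply le_of_eq; field_simp
    rw [e1, e2]
    simp only [Finset.sum_const, nsmul_eq_mul, mul_one]
    linarith
  calc ∏ t ∈ S, bern x (h t)
      ≤ ∏ t ∈ S, (bern (s / r) (h t) *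
          Real.exp (bern x (h t) / bern (s / r) (h t) - 1)) := by
        refine Finset.prod_le_prod (fun t _ => bern_nonneg hx0 hx1 _) fun t ht => ?_
        have h1 := Real.add_one_le_exp (bern x (h t) / bern (s / r) (h t) - 1)
        have h2 := mul_le_mul_of_nonneg_left h1 (hpos t ht).le
        refine le_trans (le_of_eq ?_) h2
        have := (hpos t ht).ne'
        field_simp
        ring
    _ = (∏ t ∈ S, bern (s / r) (h t)) *
          Real.exp (∑ t ∈ S, (bern x (h t) / bern (s / r) (h t) - 1)) := by
        rw [Finset.prod_mul_distrib, Real.exp_sum]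
    _ ≤ (∏ t ∈ S, bern (s / r) (h t)) * 1 := by
        refine mul_le_mul_of_nonneg_left (Real.exp_le_one_iff.2 hsum) ?_
        exact Finset.prod_nonneg fun t ht => (hpos t ht).le
    _ = _ := mul_one _

theorem Ahat_eq_card_div {nL n T : ℕ} (g : Fin T → Fin n → Bool) (z : Fin T → Fin (nL + 1))
    (i : Fin (nL + 1)) (j : Fin n) :
    Ahat g z i j = ((Finset.univ.filter fun t => z t = i ∧ g t j = true).card : ℝ) /
      (Finset.univ.filter fun t => z t = i).card := by
  simp [Ahat, Finset.sum_boole]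

theorem unitEntries_Ahat {nL n T : ℕ} (g : Fin T → Fin n → Bool) (z : Fin T → Fin (nL + 1)) :
    UnitEntries (Ahat g z) := by
  intro i j
  rw [Ahat_eq_card_div]
  refine ⟨by positivity, div_le_one_of_le₀ ?_ (by positivity)⟩
  exact_mod_cast Finset.card_le_card fun t ht => by
    simp only [Finset.mem_filter] at ht ⊢
    exact ⟨ht.1, ht.2.1⟩

/-- The likelihood factors over pairs (label, node) into one-parameter Bernoulli likelihoods, each
maximized separately. -/
theorem lik_le_lik_Ahat {nL n T : ℕ} (g : Fin T → Fin n → Bool) {A : Fin (nL + 1) → Fin n → ℝ}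
    (hA : UnitEntries A) (z : Fin T → Fin (nL + 1)) : lik g A z ≤ lik g (Ahat g z) z := by
  unfold lik
  rw [Finset.prod_comm, Finset.prod_comm (f := fun t j => bern (Ahat g z (z t) j) (g t j))]
  refine Finset.prod_le_prod (fun j _ => Finset.prod_nonneg fun t _ =>
    bern_nonneg (hA _ j).1 (hA _ j).2 _) fun j _ => ?_
  rw [← Finset.prod_fiberwise _ z, ← Finset.prod_fiberwise _ z]
  refine Finset.prod_le_prod (fun i _ => Finset.prod_nonneg fun t _ =>
    bern_nonneg (hA _ j).1 (hA _ j).2 _) fun i _ => ?_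
  have h := prod_bern_le_prod_bern_freq (Finset.univ.filter fun t => z t = i)
    (fun t => g t j) (hA i j).1 (hA i j).2
  rw [Finset.filter_filter, ← Ahat_eq_card_div] at h
  have e : ∀ B : Fin (nL + 1) → Fin n → ℝ, ∏ t with z t = i, bern (B (z t) j) (g t j) =
      ∏ t with z t = i, bern (B i j) (g t j) := fun B =>
    Finset.prod_congr rfl fun t ht => by rw [(Finset.mem_filter.1 ht).2]
  rw [e A, e (Ahat g z)]
  exact h

/-! ### Maximizers of the profile likelihood -/

section MaxProfile

variable {nL n T : ℕ} {h : nL ≤ n} {g : Fin T → Fin n → Bool} {zhat : Fin T → Fin (nL + 1)}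
  {A : Fin (nL + 1) → Fin n → ℝ}

theorem IsMaxProfile.log_lik_le (hz : IsMaxProfile h g zhat) (hA : A ∈ hubMatrices h)
    (z : Fin T → Fin (nL + 1)) :
    ENNReal.log (ENNReal.ofReal (lik g A z)) ≤ profileLogLik h g zhat := by
  rw [← condLogLik_eq_log_lik g hA.1 z]
  exact (le_iSup₂ (f := fun A (_ : A ∈ hubMatrices h) => condLogLik g A z) A hA).trans (hz z)

/-- The constrained supremum at `zhat` is bounded by the unconstrained maximum, so `Ahat` need not
be shown admissible. -/
theorem IsMaxProfile.lik_le (hz : IsMaxProfile h g zhat) (hA : A ∈ hubMatrices h)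
    (z : Fin T → Fin (nL + 1)) : lik g A z ≤ lik g (Ahat g zhat) zhat := by
  have h1 : profileLogLik h g zhat ≤ ENNReal.log (ENNReal.ofReal (lik g (Ahat g zhat) zhat)) := by
    refine iSup₂_le fun B hB => ?_
    rw [condLogLik_eq_log_lik g hB.1]
    exact ENNReal.log_le_log_iff.2 (ENNReal.ofReal_le_ofReal (lik_le_lik_Ahat g hB.1 zhat))
  have h2 := ENNReal.log_le_log_iff.1 ((hz.log_lik_le hA z).trans h1)
  exact (ENNReal.ofReal_le_ofReal_iff (lik_nonneg g (unitEntries_Ahat g zhat) zhat)).1 h2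

/-- A maximizer labels no group by an absent leader, if the data have positive likelihood. -/
theorem IsMaxProfile.hub_mem (hz : IsMaxProfile h g zhat) (hA : A ∈ hubMatrices h)
    {z : Fin T → Fin (nL + 1)} (hpos : 0 < lik g A z) {t : Fin T} {k : Fin nL}
    (ht : zhat t = k.succ) : g t (hubNode h k) = true := by
  have h1 : ⊥ < profileLogLik h g zhat := by
    refine lt_of_lt_of_le ?_ (hz.log_lik_le hA z)
    rw [bot_lt_iff_ne_bot, Ne, ENNReal.log_eq_bot_iff]
    simpa using hpos
  unfold profileLogLik at h1
  obtain ⟨B, h1⟩ := lt_iSup_iff.1 h1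
  obtain ⟨hB, h1⟩ := lt_iSup_iff.1 h1
  rw [condLogLik_eq_log_lik g hB.1, bot_lt_iff_ne_bot, Ne, ENNReal.log_eq_bot_iff] at h1
  have h2 : lik g B zhat ≠ 0 := fun h0 => h1 (by simp [h0])
  have h3 := Finset.prod_ne_zero_iff.1 (Finset.prod_ne_zero_iff.1 h2 t (Finset.mem_univ _))
    (hubNode h k) (Finset.mem_univ _)
  rw [ht, hB.2 k] at h3
  by_contra hc
  simp [bern, hc] at h3

end MaxProfile

/-! ### Sums over all data -/

theorem sum_prod_prod {n T : ℕ} (f : Fin T → Fin n → Bool → ℝ) :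
    ∑ g : Fin T → Fin n → Bool, ∏ t, ∏ j, f t j (g t j) =
      ∏ t, ∏ j, (f t j true + f t j false) := by
  rw [← Fintype.prod_sum (fun t (x : Fin n → Bool) => ∏ j, f t j (x j))]
  refine Finset.prod_congr rfl fun t _ => ?_
  rw [← Fintype.prod_sum (fun j (b : Bool) => f t j b)]
  exact Finset.prod_congr rfl fun j _ => by simp

theorem sum_lik {K n T : ℕ} (A : Fin K → Fin n → ℝ) (z : Fin T → Fin K) :
    ∑ g, lik g A z = 1 := by
  unfold lik
  rw [sum_prod_prod fun t j b => bern (A (z t) j) b]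
  simp [bern]

/-- The Bhattacharyya coefficient of two Bernoulli laws. -/
theorem bhattacharyya_le {p q : ℝ} (hp0 : 0 ≤ p) (hp1 : p ≤ 1) (hq0 : 0 ≤ q) (hq1 : q ≤ 1) :
    √(p * q) + √((1 - p) * (1 - q)) ≤ Real.exp (-((p - q) ^ 2 / 2)) := by
  have h1 : 0 ≤ 1 - p := by linarith
  have h2 : 0 ≤ 1 - q := by linarith
  set a := √(p * (1 - q))
  set b := √(q * (1 - p))
  set c := √(p * q)
  set e := √((1 - p) * (1 - q))
  have ha : a ^ 2 = p * (1 - q) := Real.sq_sqrt (by positivity)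
  have hb : b ^ 2 = q * (1 - p) := Real.sq_sqrt (by positivity)
  have hc : c ^ 2 = p * q := Real.sq_sqrt (by positivity)
  have he : e ^ 2 = (1 - p) * (1 - q) := Real.sq_sqrt (by positivity)
  -- With `a² + b² + c² + e² = 1`, this identity gives `(c + e)² = 1 - (a - b)²` and `(a + b)² = 1 -
  -- (c - e)² ≤ 1`, while `p - q = (a - b)(a + b)`.
  have hab : a * b = c * e := by
    rw [← Real.sqrt_mul (by positivity), ← Real.sqrt_mul (by positivity)]
    congr 1; ring
  have hab1 : (a + b) ^ 2 ≤ 1 := by nlinarith [sq_nonneg (c - e)]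
  have hpq : p - q = (a - b) * (a + b) := by linear_combination hb - ha
  have hsq : (c + e) ^ 2 = 1 - (a - b) ^ 2 := by linear_combination hc + he + ha + hb - 2 * hab
  have h3 : (p - q) ^ 2 ≤ 1 - (c + e) ^ 2 := by
    rw [hsq, hpq, mul_pow]; nlinarith [sq_nonneg (a - b)]
  have h4 : c + e ≤ 1 - (p - q) ^ 2 / 2 := by nlinarith [sq_nonneg (c + e - 1)]
  linarith [Real.add_one_le_exp (-((p - q) ^ 2 / 2))]

/-- The probability that a fixed alternative is at least as likely as the truth. -/
theorem sum_lik_alternative_le {K n T : ℕ} {A B : Fin K → Fin n → ℝ} (hA : UnitEntries A)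
    (hB : UnitEntries B) (z w : Fin T → Fin K) :
    ∑ g with lik g A z ≤ lik g B w, lik g A z ≤
      Real.exp (-∑ t, ∑ j, (A (z t) j - B (w t) j) ^ 2 / 2) := by
  calc ∑ g with lik g A z ≤ lik g B w, lik g A z
      ≤ ∑ g with lik g A z ≤ lik g B w, √(lik g A z * lik g B w) := by
        -- On this event the true likelihood is at most the geometric mean of the two, whose sum
        -- over all data factorizes.
        refine Finset.sum_le_sum fun g hg => Real.le_sqrt_of_sq_le ?_
        rw [sq]
        exact mul_le_mul_of_nonneg_left (Finset.mem_filter.1 hg).2 (lik_nonneg g hA z)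
    _ ≤ ∑ g, √(lik g A z * lik g B w) :=
        Finset.sum_le_sum_of_subset_of_nonneg (Finset.filter_subset _ _)
          fun _ _ _ => Real.sqrt_nonneg _
    _ = ∑ g : Fin T → Fin n → Bool,
          ∏ t, ∏ j, √(bern (A (z t) j) (g t j) * bern (B (w t) j) (g t j)) := by
        refine Finset.sum_congr rfl fun g _ => ?_
        have hb : ∀ t j, 0 ≤ bern (A (z t) j) (g t j) * bern (B (w t) j) (g t j) := fun t j =>
          mul_nonneg (bern_nonneg (hA _ j).1 (hA _ j).2 _) (bern_nonneg (hB _ j).1 (hB _ j).2 _)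
        unfold lik
        simp_rw [← Finset.prod_mul_distrib]
        rw [Real.sqrt_prod _ fun t _ => Finset.prod_nonneg fun j _ => hb t j]
        exact Finset.prod_congr rfl fun t _ => Real.sqrt_prod _ fun j _ => hb t j
    _ = ∏ t, ∏ j, (√(A (z t) j * B (w t) j) + √((1 - A (z t) j) * (1 - B (w t) j))) := by
        rw [sum_prod_prod fun t j b => √(bern (A (z t) j) b * bern (B (w t) j) b)]
        simp [bern]
    _ ≤ ∏ t, ∏ j, Real.exp (-((A (z t) j - B (w t) j) ^ 2 / 2)) := by
        refine Finset.prod_le_prod (fun t _ => Finset.prod_nonneg fun j _ => by positivity)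
          fun t _ => Finset.prod_le_prod (fun j _ => by positivity) fun j _ => ?_
        exact bhattacharyya_le (hA _ j).1 (hA _ j).2 (hB _ j).1 (hB _ j).2
    _ = _ := by
        simp_rw [← Real.exp_sum, Finset.sum_neg_distrib]

/-! ### From the confusion counts to the errors of the frequencies -/

/-- The number of groups with label `a` in `z` and label `b` in `w`. -/
def confusion {K T : ℕ} (z w : Fin T → Fin K) (a b : Fin K) : ℝ :=
  ((Finset.univ.filter fun t => z t = a ∧ w t = b).card : ℝ)

/-- The number of groups with label `a`. -/
def labelCount {K T : ℕ} (z : Fin T → Fin K) (a : Fin K) : ℝ :=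
  ((Finset.univ.filter fun t => z t = a).card : ℝ)

/-- The number of groups with label `a` that contain the node `j`. -/
def presence {K n T : ℕ} (g : Fin T → Fin n → Bool) (z : Fin T → Fin K) (a : Fin K)
    (j : Fin n) : ℝ :=
  ((Finset.univ.filter fun t => z t = a ∧ g t j = true).card : ℝ)

theorem Ahat_eq_presence_div {nL n T : ℕ} (g : Fin T → Fin n → Bool)
    (z : Fin T → Fin (nL + 1)) (i : Fin (nL + 1)) (j : Fin n) :
    Ahat g z i j = presence g z i j / labelCount z i := Ahat_eq_card_div g z i j

section Confusion

variable {K n T : ℕ}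

theorem confusion_comm (z w : Fin T → Fin K) (a b : Fin K) :
    confusion z w a b = confusion w z b a := by
  simp only [confusion, and_comm]

theorem sum_confusion (z w : Fin T → Fin K) (a : Fin K) :
    ∑ b, confusion z w a b = labelCount z a := by
  unfold confusion labelCount
  rw [Finset.card_eq_sum_card_fiberwise (f := w) (t := Finset.univ) (by simp)]
  push_cast
  simp [Finset.filter_filter]

theorem labelCount_le_confusion_add {z w : Fin T → Fin K} {η : ℝ} {a c : Fin K} (hη : 0 ≤ η)
    (h : ∀ b, b ≠ c → confusion z w a b ≤ η) :
    labelCount z a ≤ confusion z w a c + K * η := by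
  rw [← sum_confusion z w a, ← Finset.add_sum_erase _ _ (Finset.mem_univ c)]
  have h1 : ∑ b ∈ Finset.univ.erase c, confusion z w a b ≤ ∑ _b ∈ Finset.univ.erase c, η :=
    Finset.sum_le_sum fun b hb => h b (Finset.ne_of_mem_erase hb)
  have h2 : ∑ _b ∈ Finset.univ.erase c, η ≤ ∑ _b : Fin K, η :=
    Finset.sum_le_sum_of_subset_of_nonneg (Finset.subset_univ _) fun _ _ _ => hη
  simp only [Finset.sum_const, Finset.card_univ, Fintype.card_fin, nsmul_eq_mul] at h1 h2
  linarith

/-- If no label of `w` mixes two labels of `z`, every label of `z` is approximately one label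
of `w`, and these labels are distinct. -/
theorem exists_dominant {z w : Fin T → Fin K} {η : ℝ}
    (hmix : ∀ b a a', a ≠ a' → η ≤ confusion z w a b → confusion z w a' b < η)
    (hbig : ∀ a, K * η < labelCount z a) :
    ∃ σ : Fin K → Fin K, Function.Injective σ ∧ ∀ a b, b ≠ σ a → confusion z w a b ≤ η := by
  -- Each label `b` of `w` has an owner `τ b` in `z`; if no label is heavy in `b`, the owner is
  -- arbitrary. A label owning nothing would have at most `K * η` groups, so `τ` is onto, hence
  -- bijective, and `σ` is its inverse.
  have h1 : ∀ b, ∃ a, ∀ a', a' ≠ a → confusion z w a' b ≤ η := by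
    intro b
    by_cases hb : ∃ a, η ≤ confusion z w a b
    · obtain ⟨a, ha⟩ := hb
      exact ⟨a, fun a' ha' => (hmix b a a' ha'.symm ha).le⟩
    · push Not at hb
      exact ⟨b, fun a' _ => (hb a').le⟩
  choose τ hτ using h1
  have hsurj : Function.Surjective τ := by
    intro a
    by_contra hc
    push Not at hc
    have h2 : ∑ b, confusion z w a b ≤ ∑ _b : Fin K, η :=
      Finset.sum_le_sum fun b _ => hτ b a (hc b).symm
    rw [sum_confusion] at h2
    simp only [Finset.sum_const, Finset.card_univ, Fintype.card_fin, nsmul_eq_mul] at h2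
    linarith [hbig a]
  have hinj : Function.Injective τ := Finite.injective_iff_surjective.2 hsurj
  choose σ hσ using hsurj
  refine ⟨σ, fun a a' h => by rw [← hσ a, ← hσ a', h], fun a b hb => hτ b a fun h => hb ?_⟩
  exact hinj (by rw [hσ a, h])

theorem confusion_le_presence {g : Fin T → Fin n → Bool} {z w : Fin T → Fin K} {a b : Fin K}
    {j : Fin n} (h : ∀ t, w t = b → g t j = true) :
    confusion z w a b ≤ presence g z a j := by
  unfold confusion presence
  exact_mod_cast Finset.card_le_card fun t ht => by
    simp only [Finset.mem_filter] at ht ⊢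
    exact ⟨ht.1, ht.2.1, h t ht.2.2⟩

theorem presence_le_labelCount (g : Fin T → Fin n → Bool) (z : Fin T → Fin K) (a : Fin K)
    (j : Fin n) : presence g z a j ≤ labelCount z a := by
  unfold presence labelCount
  exact_mod_cast Finset.card_le_card fun t ht => by
    simp only [Finset.mem_filter] at ht ⊢
    exact ⟨ht.1, ht.2.1⟩

theorem presence_le_presence_add (g : Fin T → Fin n → Bool) {z w : Fin T → Fin K} {η : ℝ}
    {a : Fin K} (hη : 0 ≤ η) (h : ∀ b, b ≠ a → confusion z w a b ≤ η) (j : Fin n) :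
    presence g z a j ≤ presence g w a j + K * η := by
  have h1 := labelCount_le_confusion_add hη h
  have h2 : presence g z a j + confusion z w a a ≤ labelCount z a + presence g w a j := by
    unfold presence confusion labelCount
    rw [← Nat.cast_add, ← Nat.cast_add, Nat.cast_le, ← Finset.card_union_add_card_inter]
    refine Nat.add_le_add (Finset.card_le_card fun t ht => ?_)
      (Finset.card_le_card fun t ht => ?_)
    · simp only [Finset.mem_union, Finset.mem_filter] at ht ⊢
      tauto
    · simp only [Finset.mem_inter, Finset.mem_filter] at ht ⊢
      tauto
  linarith

theorem labelCount_le_labelCount_add {z w : Fin T → Fin K} {η : ℝ}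
    {a : Fin K} (hη : 0 ≤ η) (h : ∀ b, b ≠ a → confusion z w a b ≤ η) :
    labelCount z a ≤ labelCount w a + K * η := by
  have h1 := labelCount_le_confusion_add hη h
  have h2 : confusion z w a a ≤ labelCount w a := by
    unfold confusion labelCount
    exact_mod_cast Finset.card_le_card fun t ht => by
      simp only [Finset.mem_filter] at ht ⊢
      exact ⟨ht.1, ht.2.2⟩
  linarith

end Confusion

/-- Only `r` appears in the denominator of the bound, because `s' / r'` lies in `[0, 1]`, even for
`r' = 0`. -/
theorem abs_div_sub_div_le {s r s' r' e : ℝ} (hr : 0 < r) (hs' : 0 ≤ s') (hsr : s' ≤ r')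
    (h1 : |s' - s| ≤ e) (h2 : |r' - r| ≤ e) : |s' / r' - s / r| ≤ 2 * e / r := by
  have h3 : s' / r' - s / r = ((s' - s) - (s' / r') * (r' - r)) / r := by
    rcases eq_or_ne r' 0 with h | h
    · have : s' = 0 := by linarith
      simp [h, this, neg_div]
    · field_simp; ring
  have h4 : 0 ≤ s' / r' := div_nonneg hs' (hs'.trans hsr)
  have h5 : s' / r' ≤ 1 := div_le_one_of_le₀ hsr (hs'.trans hsr)
  rw [h3, abs_div, abs_of_pos hr]
  refine div_le_div_of_nonneg_right ?_ hr.le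
  calc |(s' - s) - (s' / r') * (r' - r)| ≤ |s' - s| + |(s' / r') * (r' - r)| := abs_sub _ _
    _ ≤ e + 1 * e := by
      rw [abs_mul, abs_of_nonneg h4]
      exact add_le_add h1 (mul_le_mul h5 h2 (abs_nonneg _) zero_le_one)
    _ = 2 * e := by ring

/-- The deterministic core: no mixing yields a permutation, the hubs force it to be the identity,
and the few misplaced groups cost `2 * e` beyond the error under `z`. -/
theorem maxError_le {nL n T : ℕ} (P : HubParams nL n) {g : Fin T → Fin n → Bool}
    {z w : Fin T → Fin (nL + 1)} {b e η N : ℝ} (hcross : P.CrossLE b) (he : 0 ≤ e)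
    (heb : 2 * e < 1 - b) (hη : 0 ≤ η) (hN : 0 < N) (hηN : ((nL + 1 : ℕ) : ℝ) * η ≤ e * N)
    (hcount : ∀ a, N ≤ labelCount z a) (hfreq : ∀ a j, |Ahat g z a j - P.A a j| ≤ e)
    (hmix : ∀ b a a', a ≠ a' → η ≤ confusion z w a b → confusion z w a' b < η)
    (hfeas : ∀ t (k : Fin nL), w t = k.succ → g t (hubNode P.le k) = true) :
    maxError P g w ≤ 3 * e := by
  have hpos : ∀ a, 0 < labelCount z a := fun a => hN.trans_le (hcount a)
  have hKη : ∀ a, ((nL + 1 : ℕ) : ℝ) * η ≤ e * labelCount z a := fun a =>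
    hηN.trans (mul_le_mul_of_nonneg_left (hcount a) he)
  -- Without leaders `hcross` is void, so `0 ≤ b` is not available; but then there is only one
  -- labeling.
  by_cases hnL : nL = 0
  · subst hnL
    have hzw : z = w := by funext t; exact Fin.ext (by omega)
    subst hzw
    exact Real.iSup_le (fun p => (hfreq p.1 p.2).trans (by linarith)) (by linarith)
  have hb0 : 0 ≤ b := by
    have := hcross 0 ⟨0, Nat.pos_of_ne_zero hnL⟩ (Fin.succ_ne_zero _).symm
    exact (P.A_mem.1 _ _).1.trans this
  obtain ⟨σ, hσ, hdom⟩ := exists_dominant hmix fun a => by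
    have := hpos a
    nlinarith [hKη a]
  -- If `σ a` were another leader `k`, all but a fraction `e` of the groups of `a` would contain
  -- `k`, whereas at most a fraction `b + e` do; this contradicts `2 * e < 1 - b`.
  have hσ0 : ∀ a, σ a = a ∨ σ a = 0 := by
    intro a
    by_contra hc
    push Not at hc
    obtain ⟨k, hk⟩ := Fin.exists_succ_eq.2 hc.2
    have h1 := labelCount_le_confusion_add hη (hdom a)
    have h2 : confusion z w a (σ a) ≤ presence g z a (hubNode P.le k) :=
      confusion_le_presence fun t ht => hfeas t k (ht.trans hk.symm)
    have h3 : presence g z a (hubNode P.le k) ≤ (b + e) * labelCount z a := by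
      rw [← div_le_iff₀ (hpos a), ← Ahat_eq_presence_div]
      have h4 := (abs_le.1 (hfreq a (hubNode P.le k))).2
      have h5 := hcross a k (by rw [hk]; exact hc.1.symm)
      linarith
    have := hpos a
    nlinarith [hKη a]
  have hσid : ∀ a, σ a = a := by
    intro a
    rcases hσ0 a with h | h
    · exact h
    · have h0 : σ 0 = 0 := by rcases hσ0 0 with h | h <;> exact h
      have : a = 0 := hσ (h.trans h0.symm)
      rw [this, h0]
  have hoff : ∀ a b, b ≠ a → confusion z w a b ≤ η := fun a b hb =>
    hdom a b (by rwa [hσid a])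
  have hoff' : ∀ a b, b ≠ a → confusion w z a b ≤ η := fun a b hb => by
    rw [confusion_comm]; exact hoff b a hb.symm
  refine Real.iSup_le (fun p => ?_) (by linarith)
  obtain ⟨i, j⟩ := p
  have h1 : |Ahat g w i j - Ahat g z i j| ≤ 2 * e := by
    rw [Ahat_eq_presence_div, Ahat_eq_presence_div]
    refine (abs_div_sub_div_le (e := e * labelCount z i) (hpos i) (by unfold presence; positivity)
      (presence_le_labelCount _ _ _ _) ?_ ?_).trans_eq ?_
    · have a1 := presence_le_presence_add g hη (hoff i) j
      have a2 := presence_le_presence_add g hη (hoff' i) j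
      rw [abs_le]; constructor <;> linarith [hKη i]
    · have a1 := labelCount_le_labelCount_add hη (hoff i)
      have a2 := labelCount_le_labelCount_add hη (hoff' i)
      rw [abs_le]; constructor <;> linarith [hKη i]
    · have := (hpos i).ne'
      field_simp
  have h2 := abs_add_le (Ahat g w i j - Ahat g z i j) (Ahat g z i j - P.A i j)
  rw [sub_add_sub_cancel] at h2
  show |Ahat g w i j - P.A i j| ≤ 3 * e
  linarith [hfreq i j]

/-! ### Probabilities of events as finite sums -/

open Classical in
/-- The probability of an event that depends on the true labels and the data. -/
noncomputable def hubProb {nL n : ℕ} (P : HubParams nL n) (T : ℕ)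
    (S : (Fin T → Fin (nL + 1)) → (Fin T → Fin n → Bool) → Prop) : ℝ :=
  ∑ z : Fin T → Fin (nL + 1), (∏ t, P.ρ (z t)) * ∑ g with S z g, lik g P.A z

section Prob

variable {nL n T : ℕ} {P : HubParams nL n}

theorem HubParams.prod_nonneg (P : HubParams nL n) (z : Fin T → Fin (nL + 1)) :
    0 ≤ ∏ t, P.ρ (z t) := Finset.prod_nonneg fun _ _ => P.ρ_nonneg _

theorem HubParams.lik_nonneg (P : HubParams nL n) (g : Fin T → Fin n → Bool)
    (z : Fin T → Fin (nL + 1)) : 0 ≤ lik g P.A z := _root_.lik_nonneg g P.A_mem.1 z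

theorem HubParams.sum_prod (P : HubParams nL n) :
    ∑ z : Fin T → Fin (nL + 1), ∏ t, P.ρ (z t) = 1 := by
  rw [← Fintype.prod_sum (fun (_ : Fin T) i => P.ρ i)]
  simp [P.ρ_sum]

/-- Covering the event by the finitely many atoms of `(zstar, G)` uses subadditivity only. -/
theorem IsHubSample.measure_le {Ω : Type*} [MeasurableSpace Ω] {μ : Measure Ω}
    {zstar : Ω → Fin T → Fin (nL + 1)} {G : Ω → Fin T → Fin n → Bool}
    (h : IsHubSample P μ zstar G)
    (S : (Fin T → Fin (nL + 1)) → (Fin T → Fin n → Bool) → Prop) :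
    μ {ω | S (zstar ω) (G ω)} ≤ ENNReal.ofReal (hubProb P T S) := by
  classical
  set I := (Finset.univ : Finset ((Fin T → Fin (nL + 1)) × (Fin T → Fin n → Bool))).filter
    fun x => S x.1 x.2 with hI
  have h1 : {ω | S (zstar ω) (G ω)} ⊆ ⋃ x ∈ I, {ω | zstar ω = x.1 ∧ G ω = x.2} := by
    intro ω hω
    simp only [Set.mem_iUnion]
    exact ⟨(zstar ω, G ω), by simpa [hI] using hω, rfl, rfl⟩
  refine (measure_mono h1).trans ((measure_biUnion_finset_le _ _).trans ?_)
  have h2 : ∀ x ∈ I, μ {ω | zstar ω = x.1 ∧ G ω = x.2} =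
      ENNReal.ofReal ((∏ t, P.ρ (x.1 t)) * lik x.2 P.A x.1) := by
    intro x _
    rw [h.law x.1 x.2, Finset.prod_mul_distrib]
    rfl
  rw [Finset.sum_congr rfl h2, ← ENNReal.ofReal_sum_of_nonneg fun x _ =>
    mul_nonneg (P.prod_nonneg _) (P.lik_nonneg _ _)]
  refine ENNReal.ofReal_le_ofReal (le_of_eq ?_)
  unfold hubProb
  simp_rw [hI, Finset.sum_filter, Fintype.sum_prod_type, Finset.mul_sum, mul_ite, mul_zero]

/-- Data of likelihood zero may be ignored; `IsMaxProfile.hub_mem` needs this. -/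
theorem hubProb_mono {S S' : (Fin T → Fin (nL + 1)) → (Fin T → Fin n → Bool) → Prop}
    (h : ∀ z g, 0 < lik g P.A z → S z g → S' z g) : hubProb P T S ≤ hubProb P T S' := by
  classical
  refine Finset.sum_le_sum fun z _ => mul_le_mul_of_nonneg_left ?_ (P.prod_nonneg z)
  rw [Finset.sum_filter, Finset.sum_filter]
  refine Finset.sum_le_sum fun g _ => ?_
  rcases (P.lik_nonneg g z).eq_or_lt with h0 | h0
  · simp [← h0]
  · by_cases hS : S z g
    · simp [hS, h z g h0 hS]
    · rw [if_neg hS]; split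
      · exact h0.le
      · exact le_rfl

theorem hubProb_or_le (S S' : (Fin T → Fin (nL + 1)) → (Fin T → Fin n → Bool) → Prop) :
    hubProb P T (fun z g => S z g ∨ S' z g) ≤ hubProb P T S + hubProb P T S' := by
  classical
  unfold hubProb
  rw [← Finset.sum_add_distrib]
  refine Finset.sum_le_sum fun z _ => ?_
  rw [← mul_add]
  refine mul_le_mul_of_nonneg_left ?_ (P.prod_nonneg z)
  rw [← Finset.sum_union_inter]
  refine le_add_of_le_of_nonneg (Finset.sum_le_sum_of_subset_of_nonneg (fun g hg => ?_)
    fun g _ _ => P.lik_nonneg g z) (Finset.sum_nonneg fun g _ => P.lik_nonneg g z)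
  simpa using hg

theorem hubProb_exists_le {ι : Type*} [Fintype ι]
    (S : ι → (Fin T → Fin (nL + 1)) → (Fin T → Fin n → Bool) → Prop) :
    hubProb P T (fun z g => ∃ i, S i z g) ≤ ∑ i, hubProb P T (S i) := by
  classical
  unfold hubProb
  rw [Finset.sum_comm]
  refine Finset.sum_le_sum fun z _ => ?_
  rw [← Finset.mul_sum]
  refine mul_le_mul_of_nonneg_left ?_ (P.prod_nonneg z)
  simp_rw [Finset.sum_filter]
  rw [Finset.sum_comm]
  refine Finset.sum_le_sum fun g _ => ?_
  have h0 : ∀ i ∈ (Finset.univ : Finset ι), 0 ≤ if S i z g then lik g P.A z else 0 :=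
    fun i _ => by split; exacts [P.lik_nonneg g z, le_rfl]
  split
  · next h =>
    obtain ⟨i, hi⟩ := h
    refine le_trans ?_ (Finset.single_le_sum h0 (Finset.mem_univ i))
    rw [if_pos hi]
  · exact Finset.sum_nonneg h0

open Classical in
theorem hubProb_le_of_forall {S : (Fin T → Fin (nL + 1)) → (Fin T → Fin n → Bool) → Prop}
    {δ : ℝ} (h : ∀ z, ∑ g with S z g, lik g P.A z ≤ δ) : hubProb P T S ≤ δ := by
  calc hubProb P T S ≤ ∑ z : Fin T → Fin (nL + 1), (∏ t, P.ρ (z t)) * δ :=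
        Finset.sum_le_sum fun z _ => mul_le_mul_of_nonneg_left (h z) (P.prod_nonneg z)
    _ = δ := by rw [← Finset.sum_mul, P.sum_prod, one_mul]

/-! ### The number of groups of a label -/

theorem exp_neg_one_le : Real.exp (-1) ≤ 3 / 8 := by
  rw [Real.exp_neg]
  have h := Real.exp_one_gt_d9
  rw [inv_le_comm₀ (Real.exp_pos 1) (by norm_num)]
  linarith

theorem sum_prod_exp_neg_labelCount (P : HubParams nL n) (a : Fin (nL + 1)) :
    ∑ z : Fin T → Fin (nL + 1), (∏ t, P.ρ (z t)) * Real.exp (-labelCount z a) =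
      (1 - P.ρ a * (1 - Real.exp (-1))) ^ T := by
  have h1 : ∀ z : Fin T → Fin (nL + 1), (∏ t, P.ρ (z t)) * Real.exp (-labelCount z a) =
      ∏ t, (P.ρ (z t) * if z t = a then Real.exp (-1) else 1) := by
    intro z
    rw [Finset.prod_mul_distrib, Finset.prod_ite]
    simp [labelCount, ← Real.exp_nat_mul]
  simp_rw [h1]
  rw [← Fintype.prod_sum (fun (_ : Fin T) i => P.ρ i * if i = a then Real.exp (-1) else 1)]
  simp only [Finset.prod_const, Finset.card_univ, Fintype.card_fin]
  congr 1
  have h2 : ∀ i, (P.ρ i * if i = a then Real.exp (-1) else 1) =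
      P.ρ i - if i = a then P.ρ i * (1 - Real.exp (-1)) else 0 := by
    intro i; split <;> ring
  simp_rw [h2, Finset.sum_sub_distrib, P.ρ_sum]
  simp

/-- Chernoff bound with parameter `1`; since `exp (-1) ≤ 3 / 8`, the exponent is at most `c T (1/2 -
5/8)`. -/
theorem hubProb_labelCount_lt_le {c : ℝ} {a : Fin (nL + 1)} (hc : c ≤ P.ρ a) :
    hubProb P T (fun z _ => labelCount z a < c * T / 2) ≤ Real.exp (-(c * T / 8)) := by
  classical
  rcases le_total c 0 with hc0 | hc0
  · refine (hubProb_le_of_forall (δ := 1) fun z => ?_).trans ?_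
    · rw [← sum_lik P.A z]
      exact Finset.sum_le_sum_of_subset_of_nonneg (Finset.filter_subset _ _)
        fun g _ _ => P.lik_nonneg g z
    · rw [Real.one_le_exp_iff]
      have : c * T ≤ 0 := mul_nonpos_of_nonpos_of_nonneg hc0 (by positivity)
      linarith
  calc hubProb P T (fun z _ => labelCount z a < c * T / 2)
      ≤ ∑ z : Fin T → Fin (nL + 1), (∏ t, P.ρ (z t)) *
          Real.exp (c * T / 2 - labelCount z a) := by
        refine Finset.sum_le_sum fun z _ => mul_le_mul_of_nonneg_left ?_ (P.prod_nonneg z)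
        by_cases h : labelCount z a < c * T / 2
        · simp only [h, Finset.filter_true, sum_lik]
          rw [Real.one_le_exp_iff]; linarith
        · simp only [h, Finset.filter_false, Finset.sum_empty]
          positivity
    _ = Real.exp (c * T / 2) * (1 - P.ρ a * (1 - Real.exp (-1))) ^ T := by
        rw [← sum_prod_exp_neg_labelCount, Finset.mul_sum]
        refine Finset.sum_congr rfl fun z _ => ?_
        rw [sub_eq_add_neg, Real.exp_add]; ring
    _ ≤ Real.exp (c * T / 2) * Real.exp (-(c * (1 - Real.exp (-1)))) ^ T := by
        have h1 : P.ρ a ≤ 1 := by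
          rw [← P.ρ_sum]
          exact Finset.single_le_sum (fun i _ => P.ρ_nonneg i) (Finset.mem_univ a)
        have h2 := exp_neg_one_le
        have h3 := Real.exp_pos (-1)
        have h4 := P.ρ_nonneg a
        refine mul_le_mul_of_nonneg_left (pow_le_pow_left₀ ?_ ?_ _) (Real.exp_pos _).le
        · nlinarith
        · refine le_trans ?_ (Real.add_one_le_exp _)
          nlinarith
    _ ≤ Real.exp (-(c * T / 8)) := by
        rw [← Real.exp_nat_mul, ← Real.exp_add, Real.exp_le_exp]
        have h2 := exp_neg_one_le
        have h5 : 0 ≤ c * T := by positivity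
        nlinarith

/-! ### The frequencies under the true labels -/

/-- Average `exp y ≤ 1 + y + y²`, valid for `|y| ≤ 1`; centering removes the linear term. -/
theorem bern_mgf_le {p s : ℝ} (hp0 : 0 ≤ p) (hp1 : p ≤ 1) (hs : |s| ≤ 1) :
    p * Real.exp (s * (1 - p)) + (1 - p) * Real.exp (s * (0 - p)) ≤ Real.exp (s ^ 2) := by
  have key : ∀ x : ℝ, |x| ≤ 1 → Real.exp (s * x) ≤ 1 + s * x + s ^ 2 := by
    intro x hx
    have h1 : |s * x| ≤ 1 := by rw [abs_mul]; exact mul_le_one₀ hs (abs_nonneg _) hx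
    have h2 := (abs_le.1 (Real.abs_exp_sub_one_sub_id_le h1)).2
    have h3 : x ^ 2 ≤ 1 := by rw [← sq_abs]; exact pow_le_one₀ (abs_nonneg _) hx
    nlinarith [sq_nonneg s]
  have k1 := key (1 - p) (by rw [abs_le]; constructor <;> linarith)
  have k2 := key (0 - p) (by rw [abs_le]; constructor <;> linarith)
  have h := Real.add_one_le_exp (s ^ 2)
  have h1 : 0 ≤ 1 - p := by linarith
  nlinarith [mul_le_mul_of_nonneg_left k1 hp0, mul_le_mul_of_nonneg_left k2 h1]

theorem sum_lik_mul_exp_le {K : ℕ} {A : Fin K → Fin n → ℝ} (hA : UnitEntries A)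
    (z : Fin T → Fin K) (a : Fin K) (j : Fin n) {s : ℝ} (hs : |s| ≤ 1) :
    ∑ g, lik g A z * Real.exp (s * (presence g z a j - labelCount z a * A a j)) ≤
      Real.exp (s ^ 2 * labelCount z a) := by
  have h1 : ∀ g : Fin T → Fin n → Bool,
      lik g A z * Real.exp (s * (presence g z a j - labelCount z a * A a j)) =
      ∏ t, ∏ k, (bern (A (z t) k) (g t k) * if z t = a ∧ k = j then
        Real.exp (s * ((if g t k = true then 1 else 0) - A a j)) else 1) := by
    intro g
    have h2 : presence g z a j - labelCount z a * A a j =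
        ∑ t, if z t = a then ((if g t j = true then 1 else 0) - A a j) else 0 := by
      rw [← Finset.sum_filter, Finset.sum_sub_distrib, Finset.sum_boole, Finset.filter_filter]
      simp [presence, labelCount]
    unfold lik
    simp_rw [Finset.prod_mul_distrib]
    rw [h2, Finset.mul_sum, Real.exp_sum]
    congr 1
    refine Finset.prod_congr rfl fun t _ => ?_
    by_cases ht : z t = a
    · simp [ht]
    · simp [ht]
  simp_rw [h1]
  rw [sum_prod_prod fun t k b => bern (A (z t) k) b * if z t = a ∧ k = j then
        Real.exp (s * ((if b = true then 1 else 0) - A a j)) else 1]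
  have h3 : Real.exp (s ^ 2 * labelCount z a) =
      ∏ t, ∏ k, if z t = a ∧ k = j then Real.exp (s ^ 2) else 1 := by
    have : s ^ 2 * labelCount z a = ∑ t, if z t = a then s ^ 2 else 0 := by
      rw [← Finset.sum_filter]; simp [labelCount, mul_comm]
    rw [this, Real.exp_sum]
    refine Finset.prod_congr rfl fun t _ => ?_
    by_cases ht : z t = a
    · simp [ht]
    · simp [ht]
  rw [h3]
  have h4 : ∀ t k, 0 ≤ bern (A (z t) k) true ∧ 0 ≤ bern (A (z t) k) false := fun t k =>
    ⟨bern_nonneg (hA _ _).1 (hA _ _).2 _, bern_nonneg (hA _ _).1 (hA _ _).2 _⟩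
  have h5 : ∀ t k, 0 ≤ (bern (A (z t) k) true * if z t = a ∧ k = j then
        Real.exp (s * ((if true = true then 1 else 0) - A a j)) else 1) +
      (bern (A (z t) k) false * if z t = a ∧ k = j then
        Real.exp (s * ((if false = true then 1 else 0) - A a j)) else 1) := by
    intro t k
    refine add_nonneg (mul_nonneg (h4 t k).1 ?_) (mul_nonneg (h4 t k).2 ?_) <;> split <;>
      positivity
  refine Finset.prod_le_prod (fun t _ => Finset.prod_nonneg fun k _ => h5 t k) fun t _ =>
    Finset.prod_le_prod (fun k _ => h5 t k) fun k _ => ?_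
  split
  · next h =>
    rw [h.1, h.2]
    simpa [bern] using bern_mgf_le (hA a j).1 (hA a j).2 hs
  · simp [bern]

/-- Chernoff bound with parameter `e / 2`, given the labels; the sign `σ` covers both tails. -/
theorem sum_lik_presence_ge_le {K : ℕ} {A : Fin K → Fin n → ℝ} (hA : UnitEntries A)
    (z : Fin T → Fin K) (a : Fin K) (j : Fin n) {e σ : ℝ} (he0 : 0 ≤ e) (he1 : e ≤ 1)
    (hσ : |σ| = 1) :
    ∑ g with e * labelCount z a ≤ σ * (presence g z a j - labelCount z a * A a j), lik g A z ≤
      Real.exp (-(e ^ 2 * labelCount z a / 4)) := by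
  have hs : |σ * (e / 2)| ≤ 1 := by rw [abs_mul, hσ, one_mul, abs_le]; constructor <;> linarith
  have hσ2 : σ ^ 2 = 1 := by rw [← sq_abs, hσ, one_pow]
  calc _ ≤ ∑ g, lik g A z * (Real.exp (-(e / 2 * (e * labelCount z a))) *
          Real.exp (σ * (e / 2) * (presence g z a j - labelCount z a * A a j))) := by
        rw [Finset.sum_filter]
        refine Finset.sum_le_sum fun g _ => ?_
        have h0 := lik_nonneg g hA z
        split
        · next h =>
          refine le_mul_of_one_le_right h0 ?_
          rw [← Real.exp_add, Real.one_le_exp_iff]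
          nlinarith
        · positivity
    _ = Real.exp (-(e / 2 * (e * labelCount z a))) * ∑ g, lik g A z *
          Real.exp (σ * (e / 2) * (presence g z a j - labelCount z a * A a j)) := by
        rw [Finset.mul_sum]; exact Finset.sum_congr rfl fun g _ => by ring
    _ ≤ Real.exp (-(e / 2 * (e * labelCount z a))) *
          Real.exp ((σ * (e / 2)) ^ 2 * labelCount z a) :=
        mul_le_mul_of_nonneg_left (sum_lik_mul_exp_le hA z a j hs) (Real.exp_pos _).le
    _ = _ := by
        rw [← Real.exp_add, mul_pow, hσ2]; congr 1; ring

theorem hubProb_freq_le {N e : ℝ} (hN : 0 < N) (he0 : 0 ≤ e) (he1 : e ≤ 1)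
    (a : Fin (nL + 1)) (j : Fin n) :
    hubProb P T (fun z g => N ≤ labelCount z a ∧ e < |Ahat g z a j - P.A a j|) ≤
      2 * Real.exp (-(e ^ 2 * N / 4)) := by
  classical
  refine hubProb_le_of_forall fun z => ?_
  by_cases hz : N ≤ labelCount z a
  · have hpos : 0 < labelCount z a := hN.trans_le hz
    have hsub : ∀ g : Fin T → Fin n → Bool,
        N ≤ labelCount z a ∧ e < |Ahat g z a j - P.A a j| → g ∈
        (Finset.univ.filter fun g => e * labelCount z a ≤
          1 * (presence g z a j - labelCount z a * P.A a j)) ∪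
        (Finset.univ.filter fun g => e * labelCount z a ≤
          (-1) * (presence g z a j - labelCount z a * P.A a j)) := by
      intro g hg
      simp only [Finset.mem_filter, Finset.mem_union, Finset.mem_univ, true_and] at hg ⊢
      have h1 : presence g z a j = Ahat g z a j * labelCount z a := by
        rw [Ahat_eq_presence_div]; field_simp
      rw [h1]
      rcases lt_abs.1 hg.2 with h | h
      · left; nlinarith
      · right; nlinarith
    have hexp : Real.exp (-(e ^ 2 * labelCount z a / 4)) ≤ Real.exp (-(e ^ 2 * N / 4)) := by
      rw [Real.exp_le_exp]; nlinarith [sq_nonneg e]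
    have u1 := sum_lik_presence_ge_le P.A_mem.1 z a j he0 he1 (σ := 1) (by simp)
    have u2 := sum_lik_presence_ge_le P.A_mem.1 z a j he0 he1 (σ := -1) (by simp)
    refine (Finset.sum_le_sum_of_subset_of_nonneg (fun g hg => hsub g (by simpa using hg))
      fun g _ _ => P.lik_nonneg g z).trans ?_
    have u3 := Finset.sum_union_inter (s₁ := Finset.univ.filter fun g => e * labelCount z a ≤
          1 * (presence g z a j - labelCount z a * P.A a j))
        (s₂ := Finset.univ.filter fun g => e * labelCount z a ≤
          (-1) * (presence g z a j - labelCount z a * P.A a j)) (f := fun g => lik g P.A z)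
    have u4 : 0 ≤ ∑ g ∈ (Finset.univ.filter fun g => e * labelCount z a ≤
          1 * (presence g z a j - labelCount z a * P.A a j)) ∩
        (Finset.univ.filter fun g => e * labelCount z a ≤
          (-1) * (presence g z a j - labelCount z a * P.A a j)), lik g P.A z :=
      Finset.sum_nonneg fun g _ => P.lik_nonneg g z
    linarith
  · simp only [hz, false_and, Finset.filter_false, Finset.sum_empty]
    positivity

end Prob

/-! ### Labelings that mix two labels -/

section Mixing

variable {nL n T : ℕ} {P : HubParams nL n}

/-- A label of `w` contains at least `η` groups of each of two labels of `z`. -/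
def Mixes {K T : ℕ} (η : ℝ) (z w : Fin T → Fin K) : Prop :=
  ∃ b a a', a ≠ a' ∧ η ≤ confusion z w a b ∧ η ≤ confusion z w a' b

/-- The frequencies with given numerators, for the labels `w`. -/
noncomputable def gridFreq {K n T : ℕ} (w : Fin T → Fin K) (s : Fin K → Fin n → Fin (T + 1)) :
    Fin K → Fin n → ℝ :=
  fun i j => min 1 (((s i j : ℕ) : ℝ) / labelCount w i)

theorem unitEntries_gridFreq {K : ℕ} (w : Fin T → Fin K) (s : Fin K → Fin n → Fin (T + 1)) :
    UnitEntries (gridFreq w s) := fun _ _ =>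
  ⟨le_min zero_le_one (div_nonneg (by positivity) (by unfold labelCount; positivity)),
    min_le_left _ _⟩

/-- This replaces the data-dependent matrix `Ahat g w` by one of finitely many fixed matrices, as
the union bound requires. -/
theorem exists_gridFreq_eq_Ahat (g : Fin T → Fin n → Bool) (w : Fin T → Fin (nL + 1)) :
    ∃ s, gridFreq w s = Ahat g w := by
  refine ⟨fun i j => ⟨(Finset.univ.filter fun t => w t = i ∧ g t j = true).card, ?_⟩, ?_⟩
  · exact Nat.lt_succ_of_le ((Finset.card_filter_le _ _).trans (by simp))
  · funext i j
    have h := (unitEntries_Ahat g w i j).2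
    rw [Ahat_eq_presence_div] at h ⊢
    exact min_eq_right h

theorem HubParams.Separated.le_sum_sq {d v : ℝ} (hsep : P.Separated d v) (hd : 0 < d)
    (hv : 0 < v) {a a' : Fin (nL + 1)} (h : a ≠ a') :
    v * n / (nL + 1) * d ^ 2 ≤ ∑ j, (P.A a j - P.A a' j) ^ 2 := by
  have key : ∀ (k : Fin nL) (i : Fin (nL + 1)), i ≠ k.succ →
      v * n / (nL + 1) * d ^ 2 ≤ ∑ j, (P.A k.succ j - P.A i j) ^ 2 := by
    intro k i hi
    obtain ⟨V, hV⟩ := hsep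
    have hnL : (0 : ℝ) < nL := by exact_mod_cast k.pos
    calc v * n / (nL + 1) * d ^ 2 ≤ ((V k).card : ℝ) * d ^ 2 := by
          refine mul_le_mul_of_nonneg_right (le_trans ?_ (hV k).1) (sq_nonneg d)
          exact div_le_div_of_nonneg_left (by positivity) hnL (by linarith)
      _ = ∑ _j ∈ V k, d ^ 2 := by simp
      _ ≤ ∑ j ∈ V k, (P.A k.succ j - P.A i j) ^ 2 :=
          Finset.sum_le_sum fun j hj => pow_le_pow_left₀ hd.le ((hV k).2 j hj i hi) 2
      _ ≤ _ := Finset.sum_le_sum_of_subset_of_nonneg (Finset.subset_univ _)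
          fun _ _ _ => sq_nonneg _
  by_cases h0 : a = 0
  · obtain ⟨k, hk⟩ := Fin.exists_succ_eq.2 (h0 ▸ h.symm : a' ≠ 0)
    -- Of two distinct labels at least one is a leader, and its separating set applies.
    have := key k a (by rw [hk]; exact h)
    rw [hk] at this
    simpa only [sub_sq_comm] using this
  · obtain ⟨k, hk⟩ := Fin.exists_succ_eq.2 h0
    have := key k a' (by rw [hk]; exact h.symm)
    rwa [hk] at this

theorem Mixes.le_sum_sq {d v η : ℝ} (hsep : P.Separated d v) (hd : 0 < d) (hv : 0 < v)
    (hη : 0 ≤ η) {z w : Fin T → Fin (nL + 1)} (h : Mixes η z w)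
    (B : Fin (nL + 1) → Fin n → ℝ) :
    η * (v * n / (nL + 1) * d ^ 2) / 4 ≤ ∑ t, ∑ j, (P.A (z t) j - B (w t) j) ^ 2 / 2 := by
  obtain ⟨b, a, a', hne, ha, ha'⟩ := h
  set D : Fin (nL + 1) → ℝ := fun a => ∑ j, (P.A a j - B b j) ^ 2 / 2 with hD
  have hD0 : ∀ a, 0 ≤ D a := fun a => Finset.sum_nonneg fun _ _ => by positivity
  have hfib : ∀ a, ∑ t with z t = a ∧ w t = b, ∑ j, (P.A (z t) j - B (w t) j) ^ 2 / 2 =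
      confusion z w a b * D a := by
    intro a
    rw [Finset.sum_congr rfl (g := fun _ => D a)]
    · simp [confusion]
    · intro t ht
      simp only [Finset.mem_filter] at ht
      rw [ht.2.1, ht.2.2]
  have hdisj : Disjoint (Finset.univ.filter fun t => z t = a ∧ w t = b)
      (Finset.univ.filter fun t => z t = a' ∧ w t = b) := by
    rw [Finset.disjoint_filter]
    rintro t _ ⟨h1, _⟩ ⟨h2, _⟩
    exact hne (h1.symm.trans h2)
  have h1 : confusion z w a b * D a + confusion z w a' b * D a' ≤
      ∑ t, ∑ j, (P.A (z t) j - B (w t) j) ^ 2 / 2 := by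
    rw [← hfib a, ← hfib a', ← Finset.sum_union hdisj]
    exact Finset.sum_le_sum_of_subset_of_nonneg (Finset.subset_univ _)
      fun t _ _ => Finset.sum_nonneg fun _ _ => by positivity
  have h2 : v * n / (nL + 1) * d ^ 2 / 4 ≤ D a + D a' := by
    have h3 := hsep.le_sum_sq hd hv hne
    -- No row of `B` is close to both rows: `(x - y)² ≤ 2 (x - β)² + 2 (y - β)²`.
    have h4 : (∑ j, (P.A a j - P.A a' j) ^ 2) / 4 ≤ D a + D a' := by
      rw [hD, ← Finset.sum_add_distrib, Finset.sum_div]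
      refine Finset.sum_le_sum fun j _ => ?_
      nlinarith [sq_nonneg (P.A a j - B b j + (P.A a' j - B b j))]
    linarith
  have h5 := mul_le_mul_of_nonneg_right ha (hD0 a)
  have h6 := mul_le_mul_of_nonneg_right ha' (hD0 a')
  have h7 := mul_le_mul_of_nonneg_left h2 hη
  linarith

theorem hubProb_mixes_le {d v η : ℝ} (hsep : P.Separated d v) (hd : 0 < d) (hv : 0 < v)
    (hη : 0 ≤ η) :
    hubProb P T (fun z g => ∃ w, Mixes η z w ∧ lik g P.A z ≤ lik g (Ahat g w) w) ≤
      ((nL + 1 : ℕ) : ℝ) ^ T * ((T + 1 : ℕ) : ℝ) ^ ((nL + 1) * n) *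
        Real.exp (-(η * (v * n / (nL + 1) * d ^ 2) / 4)) := by
  classical
  set x := Real.exp (-(η * (v * n / (nL + 1) * d ^ 2) / 4)) with hx
  have key : ∀ (w : Fin T → Fin (nL + 1)) (s : Fin (nL + 1) → Fin n → Fin (T + 1)),
      hubProb P T (fun z g => Mixes η z w ∧ lik g P.A z ≤ lik g (gridFreq w s) w) ≤ x := by
    intro w s
    refine hubProb_le_of_forall fun z => ?_
    by_cases hz : Mixes η z w
    · simp only [hz, true_and]
      refine (sum_lik_alternative_le P.A_mem.1 (unitEntries_gridFreq w s) z w).trans' ?_ |>.trans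
        (Real.exp_le_exp.2 (neg_le_neg (hz.le_sum_sq hsep hd hv hη _)))
      exact le_of_eq (by congr)
    · simp only [hz, false_and, Finset.filter_false, Finset.sum_empty]
      positivity
  calc _ ≤ hubProb P T (fun z g => ∃ ws : (Fin T → Fin (nL + 1)) ×
            (Fin (nL + 1) → Fin n → Fin (T + 1)), Mixes η z ws.1 ∧
            lik g P.A z ≤ lik g (gridFreq ws.1 ws.2) ws.1) := by
        refine hubProb_mono fun z g _ => ?_
        rintro ⟨w, h1, h2⟩
        obtain ⟨s, hs⟩ := exists_gridFreq_eq_Ahat g w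
        exact ⟨(w, s), h1, by rw [hs]; exact h2⟩
    _ ≤ ∑ _ws : (Fin T → Fin (nL + 1)) × (Fin (nL + 1) → Fin n → Fin (T + 1)), x :=
        (hubProb_exists_le _).trans (Finset.sum_le_sum fun ws _ => key ws.1 ws.2)
    _ = _ := by
        simp only [Finset.sum_const, Finset.card_univ, Fintype.card_prod, Fintype.card_fun,
          Fintype.card_fin, nsmul_eq_mul]
        push_cast
        rw [← pow_mul, mul_comm n]

/-! ### The finite-sample bound -/

theorem IsHubSample.measure_maxError_le {Ω : Type*} [MeasurableSpace Ω] {μ : Measure Ω}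
    {zstar : Ω → Fin T → Fin (nL + 1)} {G : Ω → Fin T → Fin n → Bool}
    {zhat : Ω → Fin T → Fin (nL + 1)} (h : IsHubSample P μ zstar G)
    (hzhat : ∀ ω, IsMaxProfile P.le (G ω) (zhat ω)) {b c d v e ε : ℝ}
    (hρ : ∀ i, c ≤ P.ρ i) (hsep : P.Separated d v) (hcross : P.CrossLE b)
    (hc : 0 < c) (hd : 0 < d) (hv : 0 < v) (hT : 0 < T) (he0 : 0 < e) (he1 : e ≤ 1)
    (heb : 2 * e < 1 - b) (heε : 3 * e < ε) :
    μ {ω | ε ≤ |maxError P (G ω) (zhat ω)|} ≤ ENNReal.ofReal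
      ((nL + 1) * Real.exp (-(c * T / 8)) +
        (nL + 1) * n * (2 * Real.exp (-(e ^ 2 * (c * T) / 8))) +
        (nL + 1) ^ T * (T + 1) ^ ((nL + 1) * n) *
          Real.exp (-(e * (c * T) * (d ^ 2 * v) * n / (8 * (nL + 1) ^ 2)))) := by
  have hcT : 0 < c * T := by positivity
  set N : ℝ := c * T / 2 with hN
  -- Chosen so that the `nL + 1` possible leaks of size `η` total a fraction `e` of the guaranteed
  -- count `N`.
  set η : ℝ := e * N / (nL + 1) with hη
  have hN0 : 0 < N := by positivity
  have hη0 : 0 ≤ η := by positivity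
  set S1 : (Fin T → Fin (nL + 1)) → (Fin T → Fin n → Bool) → Prop := fun z _ =>
    ∃ a, labelCount z a < c * T / 2 with hS1
  set S2 : (Fin T → Fin (nL + 1)) → (Fin T → Fin n → Bool) → Prop := fun z g =>
    ∃ p : Fin (nL + 1) × Fin n, N ≤ labelCount z p.1 ∧ e < |Ahat g z p.1 p.2 - P.A p.1 p.2|
    with hS2
  set S3 : (Fin T → Fin (nL + 1)) → (Fin T → Fin n → Bool) → Prop := fun z g =>
    ∃ w, Mixes η z w ∧ lik g P.A z ≤ lik g (Ahat g w) w with hS3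
  have p1 : hubProb P T S1 ≤ (nL + 1) * Real.exp (-(c * T / 8)) := by
    refine (hubProb_exists_le _).trans ((Finset.sum_le_sum fun a _ =>
      hubProb_labelCount_lt_le (hρ a)).trans_eq ?_)
    simp
  have p2 : hubProb P T S2 ≤ (nL + 1) * n * (2 * Real.exp (-(e ^ 2 * (c * T) / 8))) := by
    refine (hubProb_exists_le _).trans ((Finset.sum_le_sum fun p _ =>
      hubProb_freq_le hN0 he0.le he1 p.1 p.2).trans_eq ?_)
    simp only [Finset.sum_const, Finset.card_univ, Fintype.card_prod, Fintype.card_fin,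
      nsmul_eq_mul]
    push_cast
    congr 4
    rw [hN]; ring
  have p3 : hubProb P T S3 ≤ (nL + 1) ^ T * (T + 1) ^ ((nL + 1) * n) *
      Real.exp (-(e * (c * T) * (d ^ 2 * v) * n / (8 * (nL + 1) ^ 2))) := by
    refine (hubProb_mixes_le hsep hd hv hη0).trans_eq ?_
    push_cast
    congr 3
    rw [hη, hN]; field_simp; ring
  -- Quantifying over all maximizers makes the event depend on `(z, g)` alone, so `zhat` need not be
  -- measurable.
  set S : (Fin T → Fin (nL + 1)) → (Fin T → Fin n → Bool) → Prop := fun z g =>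
    ∃ w, IsMaxProfile P.le g w ∧ ε ≤ |maxError P g w| with hS
  have p4 : hubProb P T S ≤ hubProb P T (fun z g => (S1 z g ∨ S2 z g) ∨ S3 z g) := by
    refine hubProb_mono fun z g hpos => ?_
    rintro ⟨w, hw, hε⟩
    by_contra hcon
    push Not at hcon
    obtain ⟨⟨hn1, hn2⟩, hn3⟩ := hcon
    simp only [hS1, hS2, hS3] at hn1 hn2 hn3
    push Not at hn1 hn2 hn3
    have hle := maxError_le P (z := z) (w := w) hcross he0.le heb hη0 hN0
      (by rw [hη]; push_cast; apply le_of_eq; field_simp) hn1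
      (fun a j => hn2 (a, j) (hn1 a))
      (fun b' a a' hne ha => by
        by_contra hc'
        exact absurd (hw.lik_le P.A_mem z) (not_le.2 (hn3 w ⟨b', a, a', hne, ha, not_lt.1 hc'⟩)))
      (fun t k ht => hw.hub_mem P.A_mem hpos ht)
    have hnn : 0 ≤ maxError P g w := Real.iSup_nonneg fun _ => abs_nonneg _
    rw [abs_of_nonneg hnn] at hε
    linarith
  have p5 : μ {ω | ε ≤ |maxError P (G ω) (zhat ω)|} ≤ μ {ω | S (zstar ω) (G ω)} :=
    measure_mono fun ω hω => ⟨zhat ω, hzhat ω, hω⟩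
  refine p5.trans ((h.measure_le S).trans (ENNReal.ofReal_le_ofReal ?_))
  have p6 := hubProb_or_le (P := P) (fun z g => S1 z g ∨ S2 z g) S3
  have p7 := hubProb_or_le (P := P) S1 S2
  linarith

end Mixing

/-! ### Asymptotics -/

theorem tendsto_maxError_bound {k n T : ℕ → ℕ} {c u : ℕ → ℝ} {e : ℝ} (he0 : 0 < e)
    (hn : Tendsto n atTop atTop) (hT : Tendsto T atTop atTop)
    (hc : ∀ᶠ m in atTop, 0 < c m) (hu : ∀ m, 0 < u m)
    (h1 : Tendsto (fun m => Real.log (k m + 1) / (c m * T m)) atTop (𝓝 0))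
    (h2 : Tendsto (fun m => Real.log (n m) / (c m * T m)) atTop (𝓝 0))
    (h3 : Tendsto (fun m => ((k m : ℝ) + 1) ^ 2 * Real.log (k m + 1) / (c m * u m * n m))
      atTop (𝓝 0))
    (h4 : Tendsto (fun m => ((k m : ℝ) + 1) ^ 3 * Real.log (T m) / (c m * u m * T m))
      atTop (𝓝 0)) :
    Tendsto (fun m => ((k m : ℝ) + 1) * Real.exp (-(c m * T m / 8)) +
        (k m + 1) * n m * (2 * Real.exp (-(e ^ 2 * (c m * T m) / 8))) +
        (k m + 1) ^ T m * (T m + 1) ^ ((k m + 1) * n m) *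
          Real.exp (-(e * (c m * T m) * u m * n m / (8 * (k m + 1) ^ 2)))) atTop (𝓝 0) := by
  have hn' : Tendsto (fun m => (n m : ℝ)) atTop atTop := tendsto_natCast_atTop_atTop.comp hn
  have hlim : Tendsto (fun m => 4 / (n m : ℝ)) atTop (𝓝 0) :=
    tendsto_const_nhds.div_atTop hn'
  -- Two logarithms must fit into `c T / 8` for the first term, three into `e² c T / 8` for the
  -- second.
  set δ : ℝ := min (1 / 16) (e ^ 2 / 32) with hδ
  have hδ0 : 0 < δ := by positivity
  refine tendsto_of_tendsto_of_tendsto_of_le_of_le' tendsto_const_nhds hlim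
    (Eventually.of_forall fun m => by positivity) ?_
  filter_upwards [hn.eventually_ge_atTop 1, hT.eventually_ge_atTop 2, hc,
    h1.eventually_le_const hδ0, h2.eventually_le_const hδ0,
    h3.eventually_le_const (show 0 < e / 32 by positivity),
    h4.eventually_le_const (show 0 < e / 64 by positivity)] with m hnm hTm hcm a1 a2 a3 a4
  have hum := hu m
  have hK1 : (1 : ℝ) ≤ (k m : ℝ) + 1 := by linarith [(Nat.cast_nonneg (k m) : (0 : ℝ) ≤ k m)]
  have hn1 : (1 : ℝ) ≤ (n m : ℝ) := by exact_mod_cast hnm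
  have hT2 : (2 : ℝ) ≤ (T m : ℝ) := by exact_mod_cast hTm
  generalize hKr : (k m : ℝ) + 1 = K at *
  generalize hNr : (n m : ℝ) = N at *
  generalize hTr : (T m : ℝ) = R at *
  generalize c m = c at *
  generalize u m = u at *
  have hK0 : 0 < K := by linarith
  have hN0 : 0 < N := by linarith
  have hR0 : 0 < R := by linarith
  have hcR : 0 < c * R := by positivity
  have hexpK : Real.exp (Real.log K) = K := Real.exp_log hK0
  have hexpN : Real.exp (-Real.log N) = 1 / N := by rw [Real.exp_neg, Real.exp_log hN0, one_div]
  rw [div_le_iff₀ hcR] at a1 a2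
  have d1 : δ * (c * R) ≤ 1 / 16 * (c * R) :=
    mul_le_mul_of_nonneg_right (min_le_left _ _) hcR.le
  have d2 : δ * (c * R) ≤ e ^ 2 / 32 * (c * R) :=
    mul_le_mul_of_nonneg_right (min_le_right _ _) hcR.le
  have d3 : 0 < e ^ 2 * (c * R) := by positivity
  have b1 : K * Real.exp (-(c * R / 8)) ≤ 1 / N := by
    rw [← hexpN]
    nth_rewrite 1 [← hexpK]
    rw [← Real.exp_add, Real.exp_le_exp]
    linarith
  have b2 : K * N * (2 * Real.exp (-(e ^ 2 * (c * R) / 8))) ≤ 2 * (1 / N) := by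
    have : K * N * Real.exp (-(e ^ 2 * (c * R) / 8)) ≤ 1 / N := by
      rw [← hexpN]
      nth_rewrite 1 [← hexpK]
      nth_rewrite 1 [← Real.exp_log hN0]
      rw [← Real.exp_add, ← Real.exp_add, Real.exp_le_exp]
      linarith
    linarith
  have b3 : K ^ T m * (R + 1) ^ ((k m + 1) * n m) *
      Real.exp (-(e * (c * R) * u * N / (8 * K ^ 2))) ≤ 1 / N := by
    -- The exponent is `(e / 8) * X`. Labelings, matrices and the target factor `1 / N` each use at
    -- most `(e / 32) * X` of it.
    set X : ℝ := c * R * u * N / K ^ 2 with hX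
    have hlogR : 1 ≤ Real.log (R + 1) := by
      rw [Real.le_log_iff_exp_le (by linarith)]
      linarith [Real.exp_one_lt_d9]
    have hlogR2 : Real.log (R + 1) ≤ 2 * Real.log R := by
      rw [← Nat.cast_ofNat, ← Real.log_pow]
      exact Real.log_le_log (by linarith) (by nlinarith)
    have x1 : R * Real.log K ≤ e / 32 * X := by
      rw [div_le_iff₀ (by positivity)] at a3
      rw [hX, mul_div_assoc', le_div_iff₀ (by positivity)]
      nlinarith [mul_le_mul_of_nonneg_left a3 hR0.le]
    have x2 : K * N * Real.log (R + 1) ≤ e / 32 * X := by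
      have : K * N * Real.log R ≤ e / 64 * X := by
        rw [div_le_iff₀ (by positivity)] at a4
        rw [hX, mul_div_assoc', le_div_iff₀ (by positivity)]
        nlinarith [mul_le_mul_of_nonneg_left a4 hN0.le]
      have := mul_le_mul_of_nonneg_left hlogR2 (show 0 ≤ K * N by positivity)
      linarith
    have hX0 : 0 < e * X := by positivity
    have x3 : Real.log N ≤ K * N * Real.log (R + 1) := by
      have y1 : N ≤ K * N := le_mul_of_one_le_left hN0.le hK1
      have y2 : K * N ≤ K * N * Real.log (R + 1) :=
        le_mul_of_one_le_right (by positivity) hlogR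
      linarith [Real.log_le_self hN0.le]
    have x4 : e * (c * R) * u * N / (8 * K ^ 2) = e / 8 * X := by
      rw [hX]; field_simp
    have x5 : K ^ T m = Real.exp (R * Real.log K) := by
      rw [← hTr, Real.exp_nat_mul, hexpK]
    have x6 : (R + 1) ^ ((k m + 1) * n m) = Real.exp (K * N * Real.log (R + 1)) := by
      have : K * N = (((k m + 1) * n m : ℕ) : ℝ) := by
        rw [← hKr, ← hNr]; push_cast; rfl
      rw [this, Real.exp_nat_mul, Real.exp_log (by linarith)]
    rw [x4, x5, x6, ← hexpN, ← Real.exp_add, ← Real.exp_add, Real.exp_le_exp]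
    linarith
  have e4 : 4 / N = 1 / N + 2 * (1 / N) + 1 / N := by ring
  rw [e4]
  linarith

theorem isLittleOP_maxError {Ω : ℕ → Type*} [∀ m, MeasurableSpace (Ω m)]
    (μ : ∀ m, Measure (Ω m)) {n T : ℕ → ℕ} {d v c : ℕ → ℝ} {b : ℝ}
    (hn : Tendsto n atTop atTop) (hT : Tendsto T atTop atTop)
    (hd : ∀ m, 0 < d m) (hv : ∀ m, 0 < v m) {k : ℕ → ℕ} {P : ∀ m, HubParams (k m) (n m)}
    {zstar : ∀ m, Ω m → Fin (T m) → Fin (k m + 1)}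
    {G : ∀ m, Ω m → Fin (T m) → Fin (n m) → Bool}
    {zhat : ∀ m, Ω m → Fin (T m) → Fin (k m + 1)}
    (hb : b < 1) (hc : ∀ᶠ m in atTop, 0 < c m) (hρ : ∀ m i, c m ≤ (P m).ρ i)
    (hsep : ∀ m, (P m).Separated (d m) (v m)) (hcross : ∀ᶠ m in atTop, (P m).CrossLE b)
    (h1 : Tendsto (fun m => Real.log (k m + 1) / (c m * T m)) atTop (𝓝 0))
    (h2 : Tendsto (fun m => Real.log (n m) / (c m * T m)) atTop (𝓝 0))
    (h3 : Tendsto (fun m => ((k m : ℝ) + 1) ^ 2 * Real.log (k m + 1) /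
      (c m * (d m ^ 2 * v m) * n m)) atTop (𝓝 0))
    (h4 : Tendsto (fun m => ((k m : ℝ) + 1) ^ 3 * Real.log (T m) /
      (c m * (d m ^ 2 * v m) * T m)) atTop (𝓝 0))
    (hs : ∀ m, IsHubSample (P m) (μ m) (zstar m) (G m))
    (hzhat : ∀ m ω, IsMaxProfile (P m).le (G m ω) (zhat m ω)) :
    IsLittleOP μ (fun m ω => maxError (P m) (G m ω) (zhat m ω)) := by
  intro ε hε
  set e : ℝ := min 1 (min (ε / 4) ((1 - b) / 4)) with he
  have hb' : 0 < 1 - b := by linarith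
  have he0 : 0 < e := by positivity
  have e1 : e ≤ 1 := min_le_left _ _
  have e2 : e ≤ ε / 4 := (min_le_right _ _).trans (min_le_left _ _)
  have e3 : e ≤ (1 - b) / 4 := (min_le_right _ _).trans (min_le_right _ _)
  have hlim := ENNReal.tendsto_ofReal (tendsto_maxError_bound he0 hn hT hc
    (fun m => mul_pos (pow_pos (hd m) 2) (hv m)) h1 h2 h3 h4)
  rw [ENNReal.ofReal_zero] at hlim
  refine tendsto_of_tendsto_of_tendsto_of_le_of_le' tendsto_const_nhds hlim
    (Eventually.of_forall fun m => zero_le) ?_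
  filter_upwards [hc, hcross, hT.eventually_gt_atTop 0] with m hcm hcr hTm
  exact (hs m).measure_maxError_le (hzhat m) (hρ m) (hsep m) hcr hcm (hd m) (hv m) hTm he0 e1
    (by linarith) (by linarith)

theorem theorem10 {Ω : ℕ → Type*} [∀ m, MeasurableSpace (Ω m)] (μ : ∀ m, Measure (Ω m))
    [∀ m, IsProbabilityMeasure (μ m)] (n T : ℕ → ℕ) (d v : ℕ → ℝ)
    (hn : Tendsto n atTop atTop) (hT : Tendsto T atTop atTop)
    (hd : ∀ m, 0 < d m) (hv : ∀ m, 0 < v m) :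
    -- the number of leaders tends to infinity
    (∀ (nL : ℕ → ℕ) (P : ∀ m, HubParams (nL m) (n m)) (cmin cmax c₀ : ℝ)
      (zstar : ∀ m, Ω m → Fin (T m) → Fin (nL m + 1))
      (G : ∀ m, Ω m → Fin (T m) → Fin (n m) → Bool)
      (zhat : ∀ m, Ω m → Fin (T m) → Fin (nL m + 1)),
      Tendsto nL atTop atTop →
      0 < cmin → 0 < cmax → 0 < c₀ →
      (∀ m i, cmin / nL m ≤ (P m).ρ i ∧ (P m).ρ i ≤ cmax / nL m) →
      (∀ m, (P m).Separated (d m) (v m)) →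
      (∀ m, (P m).CrossLE (c₀ / nL m)) →
      Tendsto (fun m => (nL m : ℝ) ^ 2 * Real.log (nL m) / T m) atTop (𝓝 0) →
      Tendsto (fun m => (nL m : ℝ) ^ 5 * Real.log (T m) / (d m ^ 2 * v m * T m))
        atTop (𝓝 0) →
      Tendsto (fun m => (nL m : ℝ) ^ 8 * Real.log (nL m) / (d m ^ 4 * v m ^ 2 * n m))
        atTop (𝓝 0) →
      Tendsto (fun m => (nL m : ℝ) * Real.log (n m) / T m) atTop (𝓝 0) →
      (∀ m, IsHubSample (P m) (μ m) (zstar m) (G m)) →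
      (∀ m ω, IsMaxProfile (P m).le (G m ω) (zhat m ω)) →
      IsLittleOP μ (fun m ω => maxError (P m) (G m ω) (zhat m ω))) ∧
    -- the number of leaders is fixed
    (∀ (nL : ℕ) (P : ∀ m, HubParams nL (n m)) (cmin b : ℝ)
      (zstar : ∀ m, Ω m → Fin (T m) → Fin (nL + 1))
      (G : ∀ m, Ω m → Fin (T m) → Fin (n m) → Bool)
      (zhat : ∀ m, Ω m → Fin (T m) → Fin (nL + 1)),
      0 < cmin → b < 1 →
      (∀ m i, cmin ≤ (P m).ρ i) →
      (∀ m, (P m).Separated (d m) (v m)) →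
      (∀ m, (P m).CrossLE b) →
      Tendsto (fun m => Real.log (T m) / (d m ^ 2 * v m * T m)) atTop (𝓝 0) →
      Tendsto (fun m => d m ^ 4 * v m ^ 2 * n m) atTop atTop →
      Tendsto (fun m => Real.log (n m) / T m) atTop (𝓝 0) →
      (∀ m, IsHubSample (P m) (μ m) (zstar m) (G m)) →
      (∀ m ω, IsMaxProfile (P m).le (G m ω) (zhat m ω)) →
      IsLittleOP μ (fun m ω => maxError (P m) (G m ω) (zhat m ω))) := by
  have hdv : ∀ m, 0 < d m ^ 2 * v m := fun m => mul_pos (pow_pos (hd m) 2) (hv m)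
  have hn' : Tendsto (fun m => (n m : ℝ)) atTop atTop := tendsto_natCast_atTop_atTop.comp hn
  constructor
  · intro nL P cmin cmax c₀ zstar G zhat hnL hcmin _ hc₀ hρ hsep hcross h1 h2 h3 h4 hs hz
    have hnL' : Tendsto (fun m => (nL m : ℝ)) atTop atTop :=
      tendsto_natCast_atTop_atTop.comp hnL
    have hnL3 : ∀ᶠ m in atTop, (3 : ℝ) ≤ nL m := hnL'.eventually_ge_atTop 3
    have hlog : ∀ L : ℝ, 3 ≤ L → 0 ≤ Real.log L ∧ Real.log L ≤ L ∧
        0 ≤ Real.log (L + 1) ∧ Real.log (L + 1) ≤ 2 * Real.log L := by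
      intro L hL
      refine ⟨Real.log_nonneg (by linarith), Real.log_le_self (by linarith),
        Real.log_nonneg (by linarith), ?_⟩
      rw [← Nat.cast_ofNat, ← Real.log_pow]
      exact Real.log_le_log (by linarith) (by nlinarith)
    have hcn : ∀ᶠ m in atTop, 0 < cmin / nL m := by
      filter_upwards [hnL3] with m hm
      have : (0 : ℝ) < nL m := by linarith
      positivity
    -- `c₀ / nL` eventually drops below `1 / 2`; any constant less than `1` would do.
    refine isLittleOP_maxError μ (c := fun m => cmin / nL m) (b := 1 / 2) hn hT hd hv
      (by norm_num) hcn (fun m i => (hρ m i).1) hsep ?_ ?_ ?_ ?_ ?_ hs hz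
    · filter_upwards [hnL'.eventually_ge_atTop (2 * c₀), hnL3] with m hm hm3
      intro i k hik
      refine (hcross m i k hik).trans ?_
      rw [div_le_iff₀ (by linarith)]
      linarith
    · have hlim := h1.const_mul (2 / cmin)
      rw [mul_zero] at hlim
      refine squeeze_zero' ?_ ?_ hlim
      · filter_upwards [hnL3] with m hm
        exact div_nonneg (hlog _ hm).2.2.1 (by positivity)
      · filter_upwards [hnL3] with m hm
        obtain ⟨l1, _, l3, l4⟩ := hlog _ hm
        have hL : (0 : ℝ) < nL m := by linarith
        have e1 : Real.log (nL m + 1) / (cmin / nL m * T m) =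
            (nL m * Real.log (nL m + 1)) / T m / cmin := by field_simp
        have e2 : 2 / cmin * ((nL m : ℝ) ^ 2 * Real.log (nL m) / T m) =
            (2 * ((nL m : ℝ) ^ 2 * Real.log (nL m))) / T m / cmin := by field_simp
        rw [e1, e2]
        gcongr ?_ / _ / _
        have k1 := mul_le_mul_of_nonneg_left l4 hL.le
        have k2 : (nL m : ℝ) * Real.log (nL m) ≤ (nL m) ^ 2 * Real.log (nL m) :=
          mul_le_mul_of_nonneg_right (by nlinarith) l1
        linarith
    · have hlim := h4.div_const cmin
      rw [zero_div] at hlim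
      refine hlim.congr' ?_
      filter_upwards [hnL3] with m hm
      have hL : (0 : ℝ) < nL m := by linarith
      field_simp
    -- The rate needed is of order `nL³ log nL / (d² v n)`. Its square is dominated by the assumed
    -- rate, using `log nL ≤ nL` and dropping a factor `1 / n`.
    · have hlim := (h3.const_mul (64 / cmin ^ 2)).sqrt
      rw [mul_zero, Real.sqrt_zero] at hlim
      refine squeeze_zero' ?_ ?_ hlim
      · filter_upwards [hnL3] with m hm
        have := hdv m
        exact div_nonneg (mul_nonneg (by positivity) (hlog _ hm).2.2.1) (by positivity)
      · filter_upwards [hnL3, hn'.eventually_ge_atTop 1] with m hm hn1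
        obtain ⟨l1, l2, l3, l4⟩ := hlog _ hm
        have hL : (0 : ℝ) < nL m := by linarith
        have hu := hdv m
        have hn0 : (0 : ℝ) < n m := by linarith
        refine Real.le_sqrt_of_sq_le ?_
        have e1 : (((nL m : ℝ) + 1) ^ 2 * Real.log (nL m + 1) /
            (cmin / nL m * (d m ^ 2 * v m) * n m)) ^ 2 =
            (((nL m : ℝ) + 1) ^ 2) ^ 2 * Real.log (nL m + 1) ^ 2 * (nL m) ^ 2 /
              (cmin ^ 2 * (d m ^ 2 * v m) ^ 2 * n m) / n m := by field_simp
        have e2 : 64 / cmin ^ 2 * ((nL m : ℝ) ^ 8 * Real.log (nL m) /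
            (d m ^ 4 * v m ^ 2 * n m)) =
            64 * ((nL m : ℝ) ^ 8 * Real.log (nL m)) /
              (cmin ^ 2 * (d m ^ 2 * v m) ^ 2 * n m) := by
          have := (hd m).ne'
          have := (hv m).ne'
          field_simp
        rw [e1, e2]
        refine (div_le_self (by positivity) hn1).trans ?_
        gcongr ?_ / _
        have k1 : ((nL m : ℝ) + 1) ^ 2 ≤ 2 * (nL m : ℝ) ^ 2 := by nlinarith
        have k2 : Real.log (nL m + 1) ^ 2 ≤ 4 * (nL m * Real.log (nL m)) := by
          nlinarith [mul_le_mul_of_nonneg_right l2 l1]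
        calc (((nL m : ℝ) + 1) ^ 2) ^ 2 * Real.log (nL m + 1) ^ 2 * (nL m) ^ 2
            ≤ (2 * (nL m : ℝ) ^ 2) ^ 2 * (4 * (nL m * Real.log (nL m))) * (nL m) ^ 2 := by
              gcongr
          _ = 16 * (1 * (nL m : ℝ) ^ 7) * Real.log (nL m) := by ring
          _ ≤ 64 * (nL m * (nL m : ℝ) ^ 7) * Real.log (nL m) := by
              gcongr
              · norm_num
              · linarith
          _ = _ := by ring
    · have hlim := h2.const_mul (8 / cmin)
      rw [mul_zero] at hlim
      refine squeeze_zero' ?_ ?_ hlim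
      · filter_upwards with m
        have := hdv m
        exact div_nonneg (mul_nonneg (by positivity) (Real.log_natCast_nonneg _)) (by positivity)
      · filter_upwards [hnL3] with m hm
        have hL : (0 : ℝ) < nL m := by linarith
        have hu := hdv m
        have hlT := Real.log_natCast_nonneg (T m)
        have e1 : ((nL m : ℝ) + 1) ^ 3 * Real.log (T m) /
            (cmin / nL m * (d m ^ 2 * v m) * T m) =
            ((nL m : ℝ) + 1) ^ 3 * nL m * Real.log (T m) / (d m ^ 2 * v m * T m) / cmin := by
          field_simp
        have e2 : 8 / cmin * ((nL m : ℝ) ^ 5 * Real.log (T m) / (d m ^ 2 * v m * T m)) =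
            8 * (nL m : ℝ) ^ 5 * Real.log (T m) / (d m ^ 2 * v m * T m) / cmin := by
          field_simp
        rw [e1, e2]
        gcongr ?_ * _ / _ / _
        calc ((nL m : ℝ) + 1) ^ 3 * nL m ≤ (2 * nL m) ^ 3 * (nL m * nL m) := by
              gcongr
              · linarith
              · nlinarith
          _ = 8 * (nL m : ℝ) ^ 5 := by ring
  · intro nL P cmin b zstar G zhat hcmin hb hρ hsep hcross h1 h2 h3 hs hz
    have hun : Tendsto (fun m => d m ^ 2 * v m * n m) atTop atTop := by
      -- `d² v n` is the square root of `(d⁴ v² n) * n`.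
      have hsq := Real.tendsto_sqrt_atTop.comp (h2.atTop_mul_atTop₀ hn')
      refine hsq.congr fun m => ?_
      have : d m ^ 4 * v m ^ 2 * n m * n m = (d m ^ 2 * v m * n m) ^ 2 := by ring
      rw [Function.comp_apply, this]
      exact Real.sqrt_sq (mul_nonneg (hdv m).le (by positivity))
    have hT' : Tendsto (fun m => (T m : ℝ)) atTop atTop := tendsto_natCast_atTop_atTop.comp hT
    refine isLittleOP_maxError μ (k := fun _ => nL) (c := fun _ => cmin) (b := b) hn hT hd hv
      hb (Eventually.of_forall fun _ => hcmin) hρ hsep (Eventually.of_forall hcross)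
      ?_ ?_ ?_ ?_ hs hz
    · exact tendsto_const_nhds.div_atTop (hT'.const_mul_atTop hcmin)
    · have hlim := h3.div_const cmin
      rw [zero_div] at hlim
      exact hlim.congr fun m => by rw [div_div, mul_comm]
    · refine tendsto_const_nhds.div_atTop ?_
      simpa only [mul_assoc] using hun.const_mul_atTop hcmin
    · have hlim := h1.const_mul (((nL : ℝ) + 1) ^ 3 / cmin)
      rw [mul_zero] at hlim
      refine hlim.congr fun m => ?_
      rw [div_mul_div_comm, mul_assoc cmin]
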